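/- Let $\mathcal H_n$ be a complex Hilbert space of finite dimension $n>2$ and let $\kappa>0$. Write $\mathfrak B(\mathcal H_n)$ for the algebra of linear operators on $\mathcal H_n$, and let $\mathcal P(\mathcal H_n)$ be the projective space, identified with the submanifold of $\mathfrak B(\mathcal H_n)$ consisting of the rank-one orthogonal projectors $p=\psi\langle\psi|\cdot\rangle$, $\|\psi\|=1$. Its tangent vectors at $p$ are the operators $v=-i[A_v,p]$ with $A_v$ self-adjoint. Equip $\mathcal P(\mathcal H_n)$ with the symplectic form and the Riemannian metric ($2\kappa$ times the Fubini–Study metric) $$\omega_p(u,v)=-i\kappa\,\mathrm{tr}\big(p[A_u,A_v]\big),\qquad g_p(u,v)=-\kappa\,\mathrm{tr}\big(p([A_u,p][A_v,p]+[A_v,p][A_u,p])\big).$$ For real smooth $f,g$ let $X_f$ be the vector field with $\omega_p(X_f,\cdot)=df_p$, let $\{f,g\}=\omega(X_f,X_g)$, and let $G_p$ be the scalar product on $T_p^*\mathcal P(\mathcal H_n)$ induced by $g_p$; extend $\{f,g\}$ and $G(df,dg)$ $\mathbb C$-bilinearly to complex functions. Let $\mu_n$ be the unitarily invariant Borel probability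 measure on $\mathcal P(\mathcal H_n)$, i.e. the image of the invariant probability measure on the unit sphere. A basis of $\mathcal P(\mathcal H_n)$ is a maximal set of points at mutual Hilbert–Schmidt distance $\sqrt2$. A frame function is a map $F:\mathcal P(\mathcal H_n)\to\mathbb C$ for which $\sum_{i=1}^nF(x_i)$ has the same value for every basis $\{x_1,\dots,x_n\}$. Let $\mathcal F^2(\mathcal H_n)$ be the set of frame functions that belong to $\mathcal L^2(\mu_n)$. Finally let $$\mathcal O(A)(p)=\kappa\,\mathrm{tr}(pA)+\frac{1-\kappa}{n}\,\mathrm{tr}(A)\qquad (A\in\mathfrak B(\mathcal H_n)).$$ **Theorem.** The map $\mathcal O$ is a bijection of $\mathfrak B(\mathcal H_n)$ onto $\mathcal F^2(\mathcal H_n)$, and all elements of $\mathcal F^2(\mathcal H_n)$ are smooth. For all $f,g\in\mathcal F^2(\mathcal H_n)$ the transported $C^*$-algebra product $f\star g=\mathcal O\big(\mathcal O^{-1}(f)\,\mathcal O^{-1}(g)\big)$ is given by $$f\star g=\frac i2\{f,g\}+\frac12G(df,dg)+\frac{fg}{\kappa}+\frac{1-\kappa}{\kappa}\Big(\frac{n+1}{\kappa}\int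 fg\,d\mu_n-f\int g\,d\mu_n-g\int f\,d\mu_n\Big)+\frac{1-\kappa}{\kappa^2}\big(\kappa-(n+1)\big)\int f\,d\mu_n\int g\,d\mu_n,$$ all integrals being over $\mathcal P(\mathcal H_n)$. In particular, for $\kappa=n+1$ and with $\mu_n'=n\mu_n$, $$f\star g=\frac i2\{f,g\}+\frac12G(df,dg)+\frac1{n+1}\Big(fg-\int fg\,d\mu_n'+f\int g\,d\mu_n'+g\int f\,d\mu_n'\Big),$$ and for $\kappa=1$ $$f\star g=\frac i2\{f,g\}+\frac12G(df,dg)+fg.$$ -/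

import Mathlib

open Complex MeasureTheory Set Metric
open scoped ContDiff InnerProductSpace

noncomputable section

namespace GeomQM

section Basic

variable (H : Type*) [NormedAddCommGroup H] [InnerProductSpace ℂ H]

/-- The projective space of `H`, identified with the set of pure states, i.e. of the operators
`ψ ⟨ψ| · ⟩` with `ψ` a unit vector, and thus with an embedded submanifold of `𝔅(H)`. -/
def projSpace : Set (H →L[ℂ] H) :=
  {p | ∃ ψ : H, ‖ψ‖ = 1 ∧ p = InnerProductSpace.rankOne ℂ ψ ψ}

/-- Points of the projective space. As a subtype of `𝔅(H)` it carries the topology and the Borel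
σ-algebra induced by the operator norm. -/
abbrev PH : Type _ := ↥(projSpace H)

variable {H}

/-- The trace of an operator. -/
def tr (A : H →L[ℂ] H) : ℂ := LinearMap.trace ℂ H A.toLinearMap

/-- The projection `ψ ↦ [ψ]` of the unit sphere onto the projective space. -/
def toProj (ψ : sphere (0 : H) 1) : PH H :=
  ⟨InnerProductSpace.rankOne ℂ (ψ : H) (ψ : H), ψ, by simp, rfl⟩

end Basic

section Measure

variable (H : Type*) [NormedAddCommGroup H] [InnerProductSpace ℂ H] [FiniteDimensional ℂ H]

/-- The normalised rotation-invariant measure `ν` on the unit sphere of `H`: the measure induced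
on the sphere by Lebesgue (Haar) measure of `H`, divided by its total mass. -/
def sphereMeasure : @Measure (sphere (0 : H) 1) (@Subtype.instMeasurableSpace _ _ (borel H)) :=
  letI : MeasurableSpace H := borel H
  haveI : BorelSpace H := ⟨rfl⟩
  haveI : ProperSpace H := FiniteDimensional.proper_rclike ℂ H
  ((Measure.addHaar : Measure H).toSphere univ)⁻¹ • (Measure.addHaar : Measure H).toSphere

/-- The invariant probability measure `μ` on the projective space: the image of `ν`. -/
def projMeasure : Measure (PH H) :=
  @Measure.map _ _ (@Subtype.instMeasurableSpace _ _ (borel H)) _ toProj (sphereMeasure H)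

end Measure

section Geometry

variable {H : Type*} [NormedAddCommGroup H] [InnerProductSpace ℂ H]

theorem tr_mul_comm (A B : H →L[ℂ] H) : tr (A * B) = tr (B * A) :=
  LinearMap.trace_mul_comm ℂ A.toLinearMap B.toLinearMap

theorem tr_add (A B : H →L[ℂ] H) : tr (A + B) = tr A + tr B := by simp [tr]
theorem tr_sub (A B : H →L[ℂ] H) : tr (A - B) = tr A - tr B := by simp [tr]
theorem tr_neg (A : H →L[ℂ] H) : tr (-A) = -tr A := by simp [tr]
theorem tr_smul (c : ℂ) (A : H →L[ℂ] H) : tr (c • A) = c * tr A := by simp [tr]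

/-- The commutator. -/
def comm (A B : H →L[ℂ] H) : H →L[ℂ] H := A * B - B * A

theorem comm_add_left (A B C : H →L[ℂ] H) : comm (A + B) C = comm A C + comm B C := by
  simp only [comm, add_mul, mul_add]; abel
theorem comm_add_right (A B C : H →L[ℂ] H) : comm A (B + C) = comm A B + comm A C := by
  simp only [comm, add_mul, mul_add]; abel
theorem comm_smul_left (c : ℂ) (A B : H →L[ℂ] H) : comm (c • A) B = c • comm A B := by
  simp only [comm, smul_mul_assoc, mul_smul_comm, smul_sub]
theorem comm_smul_right (c : ℂ) (A B : H →L[ℂ] H) : comm A (c • B) = c • comm A B := by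
  simp only [comm, smul_mul_assoc, mul_smul_comm, smul_sub]
theorem real_smul (c : ℝ) (A : H →L[ℂ] H) : c • A = (c : ℂ) • A := rfl

theorem PH.idem (p : PH H) : (p : H →L[ℂ] H) * p = p := by
  obtain ⟨_, ψ, hψ, rfl⟩ := p
  exact InnerProductSpace.isIdempotentElem_rankOne_self hψ

variable [CompleteSpace H]

theorem PH.sa (p : PH H) : star (p : H →L[ℂ] H) = p := by
  obtain ⟨_, ψ, hψ, rfl⟩ := p
  exact (InnerProductSpace.isStarProjection_rankOne_self hψ).isSelfAdjoint

/-- The tangent space at `p`: the real space of all operators `-i[A, p]` with `A` self-adjoint. -/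
def tangent (p : PH H) : Submodule ℝ (H →L[ℂ] H) where
  carrier := {v | ∃ A : H →L[ℂ] H, IsSelfAdjoint A ∧ v = (-I) • (comm A (p : H →L[ℂ] H))}
  zero_mem' := ⟨0, IsSelfAdjoint.zero _, by simp [comm]⟩
  add_mem' := by
    rintro _ _ ⟨A, hA, rfl⟩ ⟨B, hB, rfl⟩
    exact ⟨A + B, hA.add hB, by rw [comm_add_left, smul_add]⟩
  smul_mem' := by
    rintro c _ ⟨A, hA, rfl⟩
    have hc : IsSelfAdjoint ((c : ℂ) • A) := by
      have hA' : star A = A := hA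
      change star ((c : ℂ) • A) = (c : ℂ) • A
      rw [star_smul, hA', RCLike.star_def, conj_ofReal]
    refine ⟨(c : ℂ) • A, hc, ?_⟩
    rw [real_smul, comm_smul_left, smul_smul, smul_smul, mul_comm]

theorem lie_mem_tangent (p : PH H) {A : H →L[ℂ] H} (hA : IsSelfAdjoint A) :
    (-I) • (comm A (p : H →L[ℂ] H)) ∈ tangent p := ⟨A, hA, rfl⟩

theorem tangent_sa {p : PH H} (v : tangent p) : star (v : H →L[ℂ] H) = v := by
  obtain ⟨_, A, hA, rfl⟩ := v
  have hA' : star A = A := hA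
  simp only [comm, star_smul, star_sub, star_mul, hA', p.sa]
  simp only [star_neg, RCLike.star_def, conj_I, neg_neg, neg_smul, smul_sub]
  abel

theorem tangent_sandwich {p : PH H} (v : tangent p) :
    (p : H →L[ℂ] H) * v * p = 0 := by
  obtain ⟨_, A, hA, rfl⟩ := v
  have hp := p.idem
  simp only [comm, mul_smul_comm, smul_mul_assoc, mul_sub, sub_mul]
  rw [mul_assoc (p : H →L[ℂ] H) (A * p) p, mul_assoc A, hp, ← mul_assoc (p : H →L[ℂ] H) p A, hp,
    ← mul_assoc, sub_self, smul_zero]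

theorem tangent_split {p : PH H} (v : tangent p) :
    (p : H →L[ℂ] H) * v + v * p = v := by
  obtain ⟨_, A, hA, rfl⟩ := v
  have hp := p.idem
  simp only [comm, mul_smul_comm, smul_mul_assoc, mul_sub, sub_mul, ← smul_add]
  rw [mul_assoc A, hp, ← mul_assoc (p : H →L[ℂ] H) p A, hp, ← mul_assoc]
  congr 1
  abel

/-- A self-adjoint generator `A_v = i[v, p]` of the tangent vector `v`, i.e. `v = -i[A_v, p]`
(see `gen_spec`). -/
def gen (p : PH H) : tangent p →ₗ[ℝ] (H →L[ℂ] H) where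
  toFun v := I • (comm (v : H →L[ℂ] H) (p : H →L[ℂ] H))
  map_add' u v := by simp [comm_add_left, smul_add]
  map_smul' c v := by
    simp only [Submodule.coe_smul, RingHom.id_apply, real_smul, comm_smul_left, smul_smul]
    rw [mul_comm]

theorem gen_sa (p : PH H) (v : tangent p) : IsSelfAdjoint (gen p v) := by
  have hv := tangent_sa v
  have hp := p.sa
  change star (I • (comm (v : H →L[ℂ] H) (p : H →L[ℂ] H))) = I • (comm (v : H →L[ℂ] H) (p : H →L[ℂ] H))
  simp only [comm, star_smul, star_sub, star_mul, hv, hp]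
  simp only [RCLike.star_def, conj_I, neg_smul, smul_sub]
  abel

theorem gen_spec (p : PH H) (v : tangent p) :
    (v : H →L[ℂ] H) = (-I) • (comm (gen p v) (p : H →L[ℂ] H)) := by
  have h1 := tangent_sandwich v
  have h2 := tangent_split v
  have hp := p.idem
  change _ = (-I) • (comm (I • (comm (v : H →L[ℂ] H) (p : H →L[ℂ] H))) (p : H →L[ℂ] H))
  simp only [comm, smul_mul_assoc, mul_smul_comm, ← smul_sub, smul_smul]
  rw [sub_mul, mul_sub, h1, ← mul_assoc, h1, mul_assoc (v : H →L[ℂ] H), hp, ← mul_assoc, hp]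
  simp [add_comm, h2]

theorem gen_lie (p : PH H) (v : tangent p) :
    (comm (gen p v) (p : H →L[ℂ] H)) = I • (v : H →L[ℂ] H) := by
  conv_rhs => rw [gen_spec p v]
  simp [smul_smul]

/-- `i[v, p]` is again a tangent vector. -/
theorem gen_mem (p : PH H) (v : tangent p) : gen p v ∈ tangent p := by
  refine ⟨-(v : H →L[ℂ] H), ?_, ?_⟩
  · have hv := tangent_sa v
    change star (-(v : H →L[ℂ] H)) = -(v : H →L[ℂ] H)
    rw [star_neg, hv]
  · change I • comm (v : H →L[ℂ] H) p = _
    simp only [comm, neg_mul, mul_neg, neg_smul, ← smul_neg]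
    congr 1
    abel

/-- `-iκ tr (p [A, B])`, the value of the symplectic form on the vectors generated by
`A` and `B`. -/
def omegaOp (κ : ℝ) (p : PH H) (A B : H →L[ℂ] H) : ℂ :=
  -(I * κ) * tr ((p : H →L[ℂ] H) * (comm A B))

/-- `-κ tr (p ([A, p][B, p] + [B, p][A, p]))`, the value of the metric on the vectors generated by
`A` and `B`. -/
def metricOp (κ : ℝ) (p : PH H) (A B : H →L[ℂ] H) : ℂ :=
  -κ * tr ((p : H →L[ℂ] H) * ((comm A (p : H →L[ℂ] H)) * (comm B (p : H →L[ℂ] H))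
    + (comm B (p : H →L[ℂ] H)) * (comm A (p : H →L[ℂ] H))))

/-- The symplectic form `ω_p (u, v) = -iκ tr (p [A_u, A_v])` (a real number, see `omega_gen`). -/
def omega (κ : ℝ) (p : PH H) : LinearMap.BilinForm ℝ (tangent p) :=
  LinearMap.mk₂ ℝ (fun u v => (omegaOp κ p (gen p u) (gen p v)).re)
    (by intro a b c; simp only [omegaOp, map_add, comm_add_left, mul_add, tr_add, add_re])
    (by
      intro r a b
      simp only [omegaOp, map_smul, real_smul, comm_smul_left, comm_smul_right, mul_smul_comm,
        tr_smul, smul_eq_mul]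
      rw [mul_left_comm, re_ofReal_mul])
    (by intro a b c; simp only [omegaOp, map_add, comm_add_right, mul_add, tr_add, add_re])
    (by
      intro r a b
      simp only [omegaOp, map_smul, real_smul, comm_smul_left, comm_smul_right, mul_smul_comm,
        tr_smul, smul_eq_mul]
      rw [mul_left_comm, re_ofReal_mul])

/-- The metric `g_p (u, v) = -κ tr (p ([A_u, p][A_v, p] + [A_v, p][A_u, p]))` (a real number, see
`metric_gen`): `2κ` times the Fubini-Study metric. -/
def metric (κ : ℝ) (p : PH H) : LinearMap.BilinForm ℝ (tangent p) :=
  LinearMap.mk₂ ℝ (fun u v => (metricOp κ p (gen p u) (gen p v)).re)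
    (by
      intro a b c
      simp only [metricOp, map_add, comm_add_left, mul_add, add_mul, tr_add, add_re]; ring)
    (by
      intro r a b
      simp only [metricOp, map_smul, real_smul, comm_smul_left, comm_smul_right, mul_smul_comm,
        smul_mul_assoc, ← smul_add, tr_smul, smul_eq_mul]
      rw [mul_left_comm, re_ofReal_mul])
    (by
      intro a b c
      simp only [metricOp, map_add, comm_add_left, mul_add, add_mul, tr_add, add_re]; ring)
    (by
      intro r a b
      simp only [metricOp, map_smul, real_smul, comm_smul_left, comm_smul_right, mul_smul_comm,
        smul_mul_assoc, ← smul_add, tr_smul, smul_eq_mul]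
      rw [mul_left_comm, re_ofReal_mul])

/-! Well-posedness and non-degeneracy of the two forms. -/

theorem metric_apply (κ : ℝ) (p : PH H) (u v : tangent p) :
    metric κ p u v = (κ * tr ((p : H →L[ℂ] H) * ((u : H →L[ℂ] H) * (v : H →L[ℂ] H)
      + (v : H →L[ℂ] H) * (u : H →L[ℂ] H)))).re := by
  change (metricOp κ p (gen p u) (gen p v)).re = _
  have h : ∀ X Y : H →L[ℂ] H, (I • X) * (I • Y) = -(X * Y) := by
    intro X Y
    rw [smul_mul_assoc, mul_smul_comm, smul_smul, I_mul_I, neg_one_smul]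
  rw [metricOp, gen_lie, gen_lie, h, h, ← neg_add, mul_neg, tr_neg]
  ring_nf

theorem omega_apply (κ : ℝ) (p : PH H) (u v : tangent p) :
    omega κ p u v = (-(I * κ) * tr ((p : H →L[ℂ] H) * comm u v)).re := by
  change (-(I * κ) * tr ((p : H →L[ℂ] H)
    * comm (I • comm (u : H →L[ℂ] H) p) (I • comm (v : H →L[ℂ] H) p))).re = _
  have key : ∀ a b : tangent p, tr ((p : H →L[ℂ] H)
      * (comm (a : H →L[ℂ] H) p * comm (b : H →L[ℂ] H) p)) = - tr ((p : H →L[ℂ] H) * ((a : H →L[ℂ] H) * (b : H →L[ℂ] H))) := by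
    intro a b
    have ha := tangent_sandwich a
    have hp := p.idem
    have h1 : (p : H →L[ℂ] H) * (comm (a : H →L[ℂ] H) p * comm (b : H →L[ℂ] H) p)
        = -((p : H →L[ℂ] H) * ((a : H →L[ℂ] H) * (b : H →L[ℂ] H)) * p) + (p : H →L[ℂ] H) * a * p * b := by
      have : (p : H →L[ℂ] H) * comm (a : H →L[ℂ] H) p = - ((p : H →L[ℂ] H) * a) := by
        rw [comm, mul_sub, ← mul_assoc, ha, ← mul_assoc, hp, zero_sub]
      rw [← mul_assoc, this, comm]
      noncomm_ring
    rw [h1, ha, zero_mul, add_zero, ← neg_one_smul ℂ, tr_smul, tr_mul_comm, ← mul_assoc, hp]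
    ring
  rw [comm_smul_left, comm_smul_right, smul_smul, mul_smul_comm, tr_smul, I_mul_I,
    comm, mul_sub, tr_sub, key, key]
  simp only [comm, mul_sub, tr_sub]
  ring_nf

theorem omega_swap (κ : ℝ) (p : PH H) (u v : tangent p) :
    omega κ p u v = - omega κ p v u := by
  simp only [omega_apply, comm, mul_sub, tr_sub]
  rw [← neg_re]
  ring_nf

theorem omega_gen_self (κ : ℝ) (p : PH H) (u : tangent p) :
    omega κ p u ⟨gen p u, gen_mem p u⟩ = metric κ p u u := by
  have hu := tangent_sandwich u
  have hp := p.idem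
  have h : (p : H →L[ℂ] H) * comm (u : H →L[ℂ] H) (gen p u)
      = I • ((p : H →L[ℂ] H) * u * u * p + p * u * u) := by
    change (p : H →L[ℂ] H) * comm (u : H →L[ℂ] H) (I • comm (u : H →L[ℂ] H) p) = _
    rw [comm_smul_right, mul_smul_comm]
    congr 1
    have : (p : H →L[ℂ] H) * comm (u : H →L[ℂ] H) (comm (u : H →L[ℂ] H) p)
        = (p : H →L[ℂ] H) * u * u * p - p * u * p * u - p * u * p * u + p * p * u * u := by
      simp only [comm]; noncomm_ring
    rw [this, hu, hp]; simp
  rw [omega_apply, metric_apply, h, tr_smul, tr_add, tr_mul_comm _ (p : H →L[ℂ] H),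
    ← mul_assoc (p : H →L[ℂ] H), ← mul_assoc (p : H →L[ℂ] H), hp, mul_add (p : H →L[ℂ] H),
    tr_add, ← mul_assoc]
  congr 1
  rw [← mul_assoc (p : H →L[ℂ] H)]
  linear_combination (-2 * κ * tr ((p : H →L[ℂ] H) * (u : H →L[ℂ] H) * (u : H →L[ℂ] H))) * I_mul_I

section Finite
variable [FiniteDimensional ℂ H]

theorem PH.tr_eq (ψ : H) (X : H →L[ℂ] H) :
    tr (InnerProductSpace.rankOne ℂ ψ ψ * X) = ⟪ψ, X ψ⟫_ℂ := by
  rw [tr_mul_comm]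
  have : X * InnerProductSpace.rankOne ℂ ψ ψ = InnerProductSpace.rankOne ℂ (X ψ) ψ := by
    ext; simp
  rw [this]
  exact InnerProductSpace.trace_rankOne (X ψ) ψ

theorem PH.conj_tr (p : PH H) (X : H →L[ℂ] H) :
    (starRingEnd ℂ) (tr ((p : H →L[ℂ] H) * X)) = tr ((p : H →L[ℂ] H) * star X) := by
  obtain ⟨_, ψ, hψ, rfl⟩ := p
  simp only [PH.tr_eq]
  rw [inner_conj_symm, ContinuousLinearMap.star_eq_adjoint, ContinuousLinearMap.adjoint_inner_right]

/-- For the rank one projector `p`, one has `p X p = tr (p X) p`. -/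
theorem PH.sandwich (p : PH H) (X : H →L[ℂ] H) :
    (p : H →L[ℂ] H) * X * p = tr ((p : H →L[ℂ] H) * X) • (p : H →L[ℂ] H) := by
  obtain ⟨_, ψ, hψ, rfl⟩ := p
  rw [PH.tr_eq]
  ext x
  simp [smul_smul, mul_comm]

theorem metric_pos {κ : ℝ} (hκ : 0 < κ) (p : PH H) {v : tangent p} (hv : v ≠ 0) :
    0 < metric κ p v v := by
  have hs := tangent_sa v
  have hsplit := tangent_split v
  have hpsa := p.sa
  obtain ⟨ψ, hψ, hpψ⟩ := p.2
  have h1 : metric κ p v v = 2 * κ * ‖(v : H →L[ℂ] H) ψ‖ ^ 2 := by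
    rw [metric_apply, hpψ, PH.tr_eq]
    have h2 : ⟪ψ, ((v : H →L[ℂ] H) * v + v * v) ψ⟫_ℂ = 2 * (‖(v : H →L[ℂ] H) ψ‖ : ℂ) ^ 2 := by
      have h3 : ⟪ψ, ((v : H →L[ℂ] H) * v) ψ⟫_ℂ = (‖(v : H →L[ℂ] H) ψ‖ : ℂ) ^ 2 := by
        have h5 := inner_self_eq_norm_sq_to_K (𝕜 := ℂ) ((v : H →L[ℂ] H) ψ)
        rw [← ContinuousLinearMap.adjoint_inner_right,
          ← ContinuousLinearMap.star_eq_adjoint, hs] at h5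
        exact h5
      rw [add_apply, inner_add_right, h3]; ring
    rw [h2]
    norm_cast
    ring
  rw [h1]
  have h4 : (v : H →L[ℂ] H) ψ ≠ 0 := by
    intro h0
    apply hv
    have hvp : (v : H →L[ℂ] H) * p = 0 := by
      rw [hpψ]; ext x; simp [h0]
    have hpv : (p : H →L[ℂ] H) * v = 0 := by
      have := congrArg star hvp
      rwa [star_mul, hs, hpsa, star_zero] at this
    rw [hvp, hpv, add_zero] at hsplit
    exact Subtype.ext hsplit.symm
  have := norm_pos_iff.mpr h4
  positivity

theorem metric_nondegenerate {κ : ℝ} (hκ : 0 < κ) (p : PH H) : (metric κ p).Nondegenerate := by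
  constructor
  · intro u hu
    by_contra h
    exact (metric_pos hκ p h).ne' (hu u)
  · intro u hu
    by_contra h
    exact (metric_pos hκ p h).ne' (hu u)

theorem omega_nondegenerate {κ : ℝ} (hκ : 0 < κ) (p : PH H) : (omega κ p).Nondegenerate := by
  have hl : ∀ u : tangent p, (∀ v, omega κ p u v = 0) → u = 0 := by
    intro u hu
    by_contra h
    exact (metric_pos hκ p h).ne' ((omega_gen_self κ p u).symm.trans (hu _))
  refine ⟨hl, fun u hu => hl u fun v => ?_⟩
  rw [omega_swap, hu, neg_zero]

theorem tr_generated (p : PH H) (X Y : H →L[ℂ] H) :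
    tr ((p : H →L[ℂ] H) * (((-I) • comm X p) * ((-I) • comm Y p)))
      = tr ((p : H →L[ℂ] H) * (X * Y)) - tr ((p : H →L[ℂ] H) * X) * tr ((p : H →L[ℂ] H) * Y) := by
  have hp := p.idem
  have h1 : tr (p : H →L[ℂ] H) = 1 := by
    obtain ⟨ψ, hψ, hpψ⟩ := p.2
    have := PH.tr_eq ψ 1
    rw [mul_one] at this
    rw [hpψ, this]
    simp [hψ]
  have h2 : (p : H →L[ℂ] H) * (comm X (p : H →L[ℂ] H) * comm Y (p : H →L[ℂ] H))
      = p * X * p * Y * p - p * (X * Y) * p := by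
    have a : (p : H →L[ℂ] H) * comm X p = p * X * p - p * X := by
      rw [comm, mul_sub, ← mul_assoc, ← mul_assoc, hp]
    have b : ((p : H →L[ℂ] H) * X * p - p * X) * comm Y p = p * X * p * Y * p - p * (X * Y) * p
        + (p * X * p * Y - p * X * (p * p) * Y) := by
      simp only [comm]; noncomm_ring
    rw [← mul_assoc, a, b, hp, sub_self, add_zero]
  rw [smul_mul_assoc, mul_smul_comm, mul_smul_comm, mul_smul_comm, tr_smul, tr_smul, h2, tr_sub,
    p.sandwich, smul_mul_assoc, smul_mul_assoc, p.sandwich, tr_smul, tr_smul, h1,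
    tr_mul_comm _ (p : H →L[ℂ] H), ← mul_assoc (p : H →L[ℂ] H) (p : H →L[ℂ] H), hp]
  linear_combination (tr ((p : H →L[ℂ] H) * X) * tr ((p : H →L[ℂ] H) * Y)
    - tr ((p : H →L[ℂ] H) * (X * Y))) * I_mul_I

theorem PH.conj_tr_mul (p : PH H) {A B : H →L[ℂ] H} (hA : IsSelfAdjoint A)
    (hB : IsSelfAdjoint B) : (starRingEnd ℂ) (tr ((p : H →L[ℂ] H) * (A * B)))
      = tr ((p : H →L[ℂ] H) * (B * A)) := by
  have hA' : star A = A := hA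
  have hB' : star B = B := hB
  rw [p.conj_tr, star_mul, hA', hB']

/-- `ω_p (-i[A, p], -i[B, p]) = -iκ tr (p [A, B])` for all self-adjoint `A`, `B`. -/
theorem omega_gen (κ : ℝ) (p : PH H) {A B : H →L[ℂ] H} (hA : IsSelfAdjoint A)
    (hB : IsSelfAdjoint B) :
    ((omega κ p ⟨_, lie_mem_tangent p hA⟩ ⟨_, lie_mem_tangent p hB⟩ : ℝ) : ℂ)
      = omegaOp κ p A B := by
  have h1 : omega κ p ⟨_, lie_mem_tangent p hA⟩ ⟨_, lie_mem_tangent p hB⟩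
      = (omegaOp κ p A B).re := by
    rw [omega_apply, omegaOp]
    congr 2
    simp only [comm.eq_1 A B, mul_sub, tr_sub]
    rw [comm, mul_sub, tr_sub, tr_generated, tr_generated]
    ring
  rw [h1]
  refine conj_eq_iff_re.mp ?_
  simp only [omegaOp, comm, mul_sub, tr_sub, map_mul, map_sub, map_neg, conj_I, conj_ofReal,
    p.conj_tr_mul hA hB, p.conj_tr_mul hB hA]
  ring

/-- `g_p (-i[A, p], -i[B, p]) = -κ tr (p ([A, p][B, p] + [B, p][A, p]))` for all self-adjoint
`A`, `B`. -/
theorem metric_gen (κ : ℝ) (p : PH H) {A B : H →L[ℂ] H} (hA : IsSelfAdjoint A)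
    (hB : IsSelfAdjoint B) :
    ((metric κ p ⟨_, lie_mem_tangent p hA⟩ ⟨_, lie_mem_tangent p hB⟩ : ℝ) : ℂ)
      = metricOp κ p A B := by
  have h0 : metricOp κ p A B = κ * tr ((p : H →L[ℂ] H) * (((-I) • comm A p) * ((-I) • comm B p)
      + ((-I) • comm B p) * ((-I) • comm A p))) := by
    simp only [metricOp, smul_mul_assoc, mul_smul_comm, smul_smul, ← smul_add, tr_smul]
    linear_combination (-κ * tr ((p : H →L[ℂ] H) * (comm A p * comm B p + comm B p * comm A p)))
      * I_mul_I
  have h1 : metric κ p ⟨_, lie_mem_tangent p hA⟩ ⟨_, lie_mem_tangent p hB⟩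
      = (metricOp κ p A B).re := by
    rw [metric_apply, h0]
  have hA' : star A = A := hA
  have hB' : star B = B := hB
  rw [h1]
  refine conj_eq_iff_re.mp ?_
  rw [h0, mul_add, tr_add, tr_generated, tr_generated]
  simp only [map_mul, map_sub, map_add, conj_ofReal, p.conj_tr_mul hA hB, p.conj_tr_mul hB hA,
    p.conj_tr, hA', hB']
  ring

end Finite
end Geometry

section Fields

variable {H : Type*} [NormedAddCommGroup H] [InnerProductSpace ℂ H] [CompleteSpace H]
  [FiniteDimensional ℂ H]

/-- Smoothness of a function on the embedded submanifold `projSpace H` of the real vector space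
`𝔅(H)`. -/
def IsSmooth (f : PH H → ℂ) : Prop :=
  ContDiffOn ℝ ∞ (Function.extend Subtype.val f 0) (projSpace H)

/-- The differential `df_p` of a real function: the derivative of `f` at `p` within the
submanifold, restricted to the tangent space at `p`. -/
def differential (f : PH H → ℝ) (p : PH H) : Module.Dual ℝ (tangent p) :=
  (fderivWithin ℝ (Function.extend Subtype.val f 0) (projSpace H) p).toLinearMap
    ∘ₗ (tangent p).subtype

/-- The Hamiltonian field of `f`: the unique field `X_f` with `ω_p (X_f, ·) = df_p`. -/
def hamField {κ : ℝ} (hκ : 0 < κ) (f : PH H → ℝ) (p : PH H) : tangent p :=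
  ((omega κ p).toDual (omega_nondegenerate hκ p)).symm (differential f p)

/-- The Poisson bracket `{f, g} = ω (X_f, X_g)` of real functions. -/
def poissonReal {κ : ℝ} (hκ : 0 < κ) (f g : PH H → ℝ) (p : PH H) : ℝ :=
  omega κ p (hamField hκ f p) (hamField hκ g p)

/-- The scalar product `G_p` on covectors at `p` canonically induced by the metric `g_p`. -/
def coMetric {κ : ℝ} (hκ : 0 < κ) (p : PH H) (α β : Module.Dual ℝ (tangent p)) : ℝ :=
  metric κ p (((metric κ p).toDual (metric_nondegenerate hκ p)).symm α)
    (((metric κ p).toDual (metric_nondegenerate hκ p)).symm β)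

/-- The `ℂ`-bilinear extension to complex functions of an operation on real functions. -/
def complexify (B : (PH H → ℝ) → (PH H → ℝ) → PH H → ℝ) (f g : PH H → ℂ) (p : PH H) : ℂ :=
  ((B (fun q => (f q).re) (fun q => (g q).re) p - B (fun q => (f q).im) (fun q => (g q).im) p : ℝ)
      : ℂ)
    + I * ((B (fun q => (f q).re) (fun q => (g q).im) p
      + B (fun q => (f q).im) (fun q => (g q).re) p : ℝ) : ℂ)

/-- The Poisson bracket `{f, g}` of complex functions. -/
def poisson {κ : ℝ} (hκ : 0 < κ) (f g : PH H → ℂ) : PH H → ℂ :=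
  complexify (poissonReal hκ) f g

/-- The function `G(df, dg)` for complex `f` and `g`. -/
def gradProd {κ : ℝ} (hκ : 0 < κ) (f g : PH H → ℂ) : PH H → ℂ :=
  complexify (fun u v p => coMetric hκ p (differential u p) (differential v p)) f g

/-- The Hilbert-Schmidt distance of two points of the projective space. -/
def hsDist (p q : PH H) : ℝ :=
  Real.sqrt (tr (star ((p : H →L[ℂ] H) - (q : H →L[ℂ] H)) * ((p : H →L[ℂ] H) - (q : H →L[ℂ] H)))).re

/-- A basis of the projective space: a maximal set of points at mutual distance `√2`. -/
def IsProjBasis (N : Set (PH H)) : Prop :=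
  Maximal (fun M : Set (PH H) => M.Pairwise fun p q => hsDist p q = Real.sqrt 2) N

/-- Frame functions. (All bases of the projective space are finite.) -/
def IsFrameFunction (F : PH H → ℂ) : Prop :=
  ∃ W : ℂ, ∀ N : Finset (PH H), IsProjBasis (N : Set (PH H)) → ∑ p ∈ N, F p = W

variable (H) in
/-- The set `𝓕²(H)` of the square-integrable frame functions. -/
def frameL2 : Set (PH H → ℂ) :=
  {F | MemLp F 2 (projMeasure H) ∧ IsFrameFunction F}

/-- The map `𝒪 : A ↦ f_A`, `f_A (p) = κ tr (p A) + c_κ tr A` with `c_κ = (1 - κ) / n`. -/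
def obs (κ : ℝ) (A : H →L[ℂ] H) (p : PH H) : ℂ :=
  κ * tr ((p : H →L[ℂ] H) * A) + ((1 - κ) / Module.finrank ℂ H) * tr A

/-- The transported product `f ⋆ g = 𝒪 (𝒪⁻¹ f 𝒪⁻¹ g)`. -/
def starProd (κ : ℝ) (f g : PH H → ℂ) : PH H → ℂ :=
  obs κ (Function.invFun (obs κ) f * Function.invFun (obs κ) g)

end Fields

section MeasureFacts

open scoped Pointwise

variable {H : Type*} [NormedAddCommGroup H] [InnerProductSpace ℂ H] [FiniteDimensional ℂ H]

theorem continuous_toProj : Continuous (toProj (H := H)) := by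
  apply Continuous.subtype_mk
  exact (isBoundedBilinearMap_smulRight (𝕜 := ℂ) (E := H) (F := H)).continuous.comp
    (((innerSL ℂ).continuous.comp continuous_subtype_val).prodMk continuous_subtype_val)

/-- The action of a unitary operator on the sphere. -/
def sphereAct (U : H ≃ₗᵢ[ℂ] H) (ψ : sphere (0 : H) 1) : sphere (0 : H) 1 :=
  ⟨U ψ, by simp⟩

instance projMeasure_isProbabilityMeasure [Nontrivial H] :
    IsProbabilityMeasure (projMeasure H) := by
  let _ : MeasurableSpace H := borel H
  have : BorelSpace H := ⟨rfl⟩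
  have : ProperSpace H := FiniteDimensional.proper_rclike ℂ H
  have h : IsProbabilityMeasure (sphereMeasure H) := by
    constructor
    rw [sphereMeasure, Measure.smul_apply, smul_eq_mul]
    apply ENNReal.inv_mul_cancel
    · rw [Measure.measure_univ_ne_zero]
      exact Measure.toSphere_ne_zero _
    · exact measure_ne_top _ _
  exact Measure.isProbabilityMeasure_map continuous_toProj.measurable.aemeasurable

/-- The measure `ν` on the sphere is invariant under unitary operators. -/
theorem sphereMeasure_map (U : H ≃ₗᵢ[ℂ] H) :
    @Measure.map _ _ (@Subtype.instMeasurableSpace _ _ (borel H))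
      (@Subtype.instMeasurableSpace _ _ (borel H)) (sphereAct U) (sphereMeasure H)
      = sphereMeasure H := by
  let _ : MeasurableSpace H := borel H
  have : BorelSpace H := ⟨rfl⟩
  have : ProperSpace H := FiniteDimensional.proper_rclike ℂ H
  have hm : Measurable (sphereAct U) := by
    apply Continuous.measurable
    apply Continuous.subtype_mk
    fun_prop
  let μ : Measure H := Measure.addHaar
  have hμ : ∀ s : Set H, μ (U ⁻¹' s) = μ s := by
    intro s
    let f : H →ₗ[ℝ] H := (U.toLinearEquiv.restrictScalars ℝ : H ≃ₗ[ℝ] H)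
    have hdet : LinearMap.det f ≠ 0 := (LinearEquiv.isUnit_det' _).ne_zero
    have h1 := Measure.addHaar_preimage_linearMap μ hdet (ball 0 1)
    have h2 : f ⁻¹' (ball 0 1) = ball 0 1 := by
      ext x
      have : f x = U x := rfl
      simp [this]
    rw [h2] at h1
    have h3 : μ (ball (0 : H) 1) ≠ 0 := (measure_ball_pos μ 0 one_pos).ne'
    have h4 : μ (ball (0 : H) 1) ≠ ⊤ := measure_ball_lt_top.ne
    have h5 : ENNReal.ofReal |(LinearMap.det f)⁻¹| = 1 := by
      have := (ENNReal.eq_div_iff h3 h4).mpr ((mul_comm _ _).trans h1.symm)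
      rwa [ENNReal.div_self h3 h4] at this
    have h6 := Measure.addHaar_preimage_linearMap μ hdet s
    rw [h5, one_mul] at h6
    exact h6
  have hset : ∀ s : Set (sphere (0 : H) 1),
      U ⁻¹' (Ioo (0 : ℝ) 1 • ((↑) '' s)) = Ioo (0 : ℝ) 1 • ((↑) '' (sphereAct U ⁻¹' s)) := by
    intro s
    ext x
    simp only [mem_preimage, mem_smul, mem_image]
    constructor
    · rintro ⟨r, hr, _, ⟨ψ, hψ, rfl⟩, hx⟩
      refine ⟨r, hr, U.symm ψ, ⟨⟨U.symm ψ, by simp⟩, ?_, rfl⟩, ?_⟩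
      · simpa [sphereAct] using hψ
      · apply U.injective
        rw [← hx, ← Complex.coe_smul, ← Complex.coe_smul, map_smul]
        simp
    · rintro ⟨r, hr, _, ⟨ψ, hψ, rfl⟩, rfl⟩
      refine ⟨r, hr, U ψ, ⟨sphereAct U ψ, hψ, rfl⟩, ?_⟩
      rw [← Complex.coe_smul, ← Complex.coe_smul, map_smul]
  ext s hs
  rw [Measure.map_apply hm hs, sphereMeasure, Measure.smul_apply, Measure.smul_apply,
    Measure.toSphere_apply' _ hs, Measure.toSphere_apply' _ (hm hs), ← hset, hμ]

end MeasureFacts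
end GeomQM
end

/-!
The map `𝒪` lands in the frame functions because the points of a finite basis of the projective
space are the projectors of an orthonormal basis, over which `tr (pA)` sums to `tr A`; it is
injective because expectation values in pure states determine an operator.

Surjectivity is Gleason's theorem for square-integrable frame functions (`exists_eq_tr`). Fix a unit
vector `e` and average a frame function `F` of weight `W` over the unitary operators fixing `e`. The
average at `x` depends only on `t = |⟨e, x⟩|²`, say it is `h t`, and since every probability vector
arises as `(|⟨e, bᵢ⟩|²)ᵢ` for some orthonormal basis `b`, the frame property says that `∑ h (tᵢ) = W`
for all probability vectors. In dimension at least three this makes `h - h 0` additive on `[0, 1]`,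
hence linear, since it is measurable (`zonalProfile_affine`). As `h 1 = F e`, averaging `F` against
`|⟨e, x⟩|²` gives `(F e + W) / (n (n + 1))` (`integral_transition_mul`), while that mean is
`tr (|e⟩⟨e| B)` with `B = ∫ F(p) p dμ`. So `F` is an expectation value at *every* point. The average
over an orbit could a priori diverge on the null sets of interest; the set of good `t` has full
measure because a property that holds almost everywhere on the sphere holds almost everywhere along
some arc issuing from `e` (`exists_slice`), and the frame property propagates goodness to all of `[0, 1]`.

For the product formula, the Hamiltonian field and the gradient of the observable of a self-adjoint
`A` are `-i[A, p]` and `[[A, p], p]`, so that `{f_A, f_B} = -iκ tr (p[A, B])` and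
`G(df_A, df_B) = κ (tr (p(AB + BA)) - 2 tr (pA) tr (pB))`. Hence the two terms with derivatives add up
to `κ tr (pAB) - κ tr (pA) tr (pB)`, and the rest is accounted for by the moments
`∫ tr (pA) tr (pB) dμ = (tr A tr B + tr (AB)) / (n (n + 1))` (`secondMoment_eq`).
-/

noncomputable section

namespace GeomQM

/-! ### Bases of the projective space and orthonormal bases -/

section Bases

variable {H : Type*} [NormedAddCommGroup H] [InnerProductSpace ℂ H]

theorem toProj_surjective (p : PH H) : ∃ ψ : sphere (0 : H) 1, toProj ψ = p := by
  obtain ⟨_, ψ, hψ, rfl⟩ := p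
  exact ⟨⟨ψ, by simpa using hψ⟩, rfl⟩

/-- The members of an orthonormal basis as points of the unit sphere. -/
def basisVec {ι : Type*} [Fintype ι] (b : OrthonormalBasis ι ℂ H) (i : ι) : sphere (0 : H) 1 :=
  ⟨b i, by simp⟩

theorem tr_rankOne_mul [FiniteDimensional ℂ H] (ψ : sphere (0 : H) 1) (A : H →L[ℂ] H) :
    tr ((toProj ψ : H →L[ℂ] H) * A) = ⟪(ψ : H), A ψ⟫_ℂ := PH.tr_eq (ψ : H) A

theorem tr_eq_sum [FiniteDimensional ℂ H] {ι : Type*} [Fintype ι] (b : OrthonormalBasis ι ℂ H)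
    (A : H →L[ℂ] H) : tr A = ∑ i, ⟪b i, A (b i)⟫_ℂ :=
  LinearMap.trace_eq_sum_inner _ b

theorem tr_toProj [FiniteDimensional ℂ H] (ψ : sphere (0 : H) 1) :
    tr (toProj ψ : H →L[ℂ] H) = 1 := by
  have := tr_rankOne_mul ψ 1
  rw [mul_one] at this
  rw [this]
  simp

theorem tr_coe [FiniteDimensional ℂ H] (p : PH H) : tr (p : H →L[ℂ] H) = 1 := by
  obtain ⟨ψ, rfl⟩ := toProj_surjective p
  exact tr_toProj ψ

variable [FiniteDimensional ℂ H] [CompleteSpace H]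

theorem tr_toProj_mul_toProj (ψ φ : sphere (0 : H) 1) :
    tr ((toProj ψ : H →L[ℂ] H) * (toProj φ : H →L[ℂ] H))
      = ((‖⟪(ψ : H), (φ : H)⟫_ℂ‖ ^ 2 : ℝ) : ℂ) := by
  rw [tr_rankOne_mul]
  change ⟪(ψ : H), InnerProductSpace.rankOne ℂ (φ : H) (φ : H) ψ⟫_ℂ = _
  rw [InnerProductSpace.rankOne_apply, inner_smul_right, ← inner_conj_symm,
    ← normSq_eq_conj_mul_self, normSq_eq_norm_sq, norm_inner_symm]

theorem hsDist_eq_sqrt_two_iff (ψ φ : sphere (0 : H) 1) :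
    hsDist (toProj ψ) (toProj φ) = Real.sqrt 2 ↔ ⟪(ψ : H), (φ : H)⟫_ℂ = 0 := by
  have h1 : tr (star ((toProj ψ : H →L[ℂ] H) - (toProj φ : H →L[ℂ] H))
      * ((toProj ψ : H →L[ℂ] H) - (toProj φ : H →L[ℂ] H)))
      = ((2 - 2 * ‖⟪(ψ : H), (φ : H)⟫_ℂ‖ ^ 2 : ℝ) : ℂ) := by
    rw [star_sub, PH.sa, PH.sa, sub_mul, mul_sub, mul_sub, tr_sub, tr_sub, tr_sub, PH.idem, PH.idem,
      tr_toProj, tr_toProj, tr_mul_comm (toProj φ : H →L[ℂ] H), tr_toProj_mul_toProj]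
    push_cast
    ring
  have h3 : ‖⟪(ψ : H), (φ : H)⟫_ℂ‖ ≤ 1 := by
    have := norm_inner_le_norm (𝕜 := ℂ) (ψ : H) (φ : H)
    simpa using this
  have h4 : 0 ≤ 2 - 2 * ‖⟪(ψ : H), (φ : H)⟫_ℂ‖ ^ 2 := by
    nlinarith [norm_nonneg ⟪(ψ : H), (φ : H)⟫_ℂ]
  rw [hsDist, h1, ofReal_re, Real.sqrt_inj h4 (by norm_num)]
  constructor
  · intro h
    have : ‖⟪(ψ : H), (φ : H)⟫_ℂ‖ ^ 2 = 0 := by linarith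
    simpa using this
  · intro h
    simp [h]

/-- A finite basis of the projective space comes from an orthonormal basis of `H`. -/
theorem IsProjBasis.exists_orthonormalBasis {N : Finset (PH H)}
    (hN : IsProjBasis (N : Set (PH H))) :
    ∃ b : OrthonormalBasis N ℂ H, ∀ p : N, toProj (basisVec b p) = p := by
  choose ψ hψ using fun p : N => toProj_surjective (p : PH H)
  have hon : Orthonormal ℂ (fun p : N => (ψ p : H)) := by
    refine ⟨fun p => by simp, fun p q hpq => ?_⟩
    refine (hsDist_eq_sqrt_two_iff (ψ p) (ψ q)).mp ?_
    rw [hψ, hψ]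
    exact hN.prop p.2 q.2 fun h => hpq (Subtype.ext h)
  have hbot : (Submodule.span ℂ (range fun p : N => (ψ p : H)))ᗮ = ⊥ := by
    rw [Submodule.eq_bot_iff]
    intro x hx
    by_contra hx0
    -- a unit vector orthogonal to all the `ψ p` would enlarge the basis
    let φ : sphere (0 : H) 1 := ⟨(‖x‖⁻¹ : ℂ) • x, by
      have : ‖x‖ ≠ 0 := norm_ne_zero_iff.mpr hx0
      simp [norm_smul, this]⟩
    have horth : ∀ p : N, ⟪(ψ p : H), (φ : H)⟫_ℂ = 0 := by
      intro p
      have := (Submodule.mem_orthogonal _ _).mp hx (ψ p) (Submodule.subset_span ⟨p, rfl⟩)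
      simp [φ, this]
    have hmem : toProj φ ∈ (N : Set (PH H)) := by
      refine hN.le_of_ge (y := insert (toProj φ) (N : Set (PH H))) ?_ (subset_insert _ _)
        (mem_insert _ _)
      refine hN.prop.insert fun q hq _ => ?_
      have h1 : hsDist q (toProj φ) = Real.sqrt 2 := by
        have := (hsDist_eq_sqrt_two_iff (ψ ⟨q, hq⟩) φ).mpr (horth ⟨q, hq⟩)
        rwa [hψ] at this
      have h2 : hsDist (toProj φ) q = Real.sqrt 2 := by
        have := (hsDist_eq_sqrt_two_iff φ (ψ ⟨q, hq⟩)).mpr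
          (by rw [← inner_conj_symm, horth ⟨q, hq⟩, map_zero])
        rwa [hψ] at this
      exact ⟨h2, h1⟩
    have h3 := (hsDist_eq_sqrt_two_iff (ψ ⟨_, hmem⟩) φ).mpr (horth ⟨_, hmem⟩)
    rw [hψ] at h3
    have h4 := (hsDist_eq_sqrt_two_iff φ φ).mp h3
    simp at h4
  refine ⟨OrthonormalBasis.mkOfOrthogonalEqBot hon hbot, fun p => ?_⟩
  rw [← hψ p]
  congr 1
  apply Subtype.ext
  simp [basisVec]

/-- An orthonormal basis of `H` gives a basis of the projective space, so that the values of a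
frame function over it add up to the weight. -/
theorem sum_frame_orthonormalBasis {F : PH H → ℂ} {W : ℂ}
    (hF : ∀ N : Finset (PH H), IsProjBasis (N : Set (PH H)) → ∑ p ∈ N, F p = W)
    {ι : Type*} [Fintype ι] (b : OrthonormalBasis ι ℂ H) :
    ∑ i, F (toProj (basisVec b i)) = W := by
  classical
  have hinj : Function.Injective fun i => toProj (basisVec b i) := by
    intro i j hij
    by_contra hne
    have h1 := (hsDist_eq_sqrt_two_iff (basisVec b i) (basisVec b j)).mpr
      (b.orthonormal.2 hne)
    have hij' : toProj (basisVec b i) = toProj (basisVec b j) := hij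
    rw [hij', hsDist_eq_sqrt_two_iff] at h1
    simp at h1
  have hbasis : IsProjBasis ((Finset.univ.image fun i => toProj (basisVec b i) : Finset (PH H)) :
      Set (PH H)) := by
    constructor
    · rintro p hp q hq hpq
      simp only [Finset.coe_image, Finset.coe_univ, image_univ, mem_range] at hp hq
      obtain ⟨i, rfl⟩ := hp
      obtain ⟨j, rfl⟩ := hq
      exact (hsDist_eq_sqrt_two_iff _ _).mpr (b.orthonormal.2 fun h => hpq (by rw [h]))
    · intro M hM hle q hq
      by_contra hqN
      obtain ⟨φ, rfl⟩ := toProj_surjective q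
      have horth : ∀ i, ⟪b i, (φ : H)⟫_ℂ = 0 := by
        intro i
        refine (hsDist_eq_sqrt_two_iff (basisVec b i) φ).mp (hM (hle (by simp)) hq ?_)
        intro h
        exact hqN (by simp [← h])
      have h0 : (φ : H) = 0 := by
        rw [← b.sum_repr' (φ : H)]
        simp [horth]
      have := norm_eq_of_mem_sphere φ
      rw [h0] at this
      simp at this
  have := hF _ hbasis
  rwa [Finset.sum_image fun i _ j _ h => hinj h] at this

theorem IsProjBasis.sum_tr {N : Finset (PH H)} (hN : IsProjBasis (N : Set (PH H)))
    (A : H →L[ℂ] H) : ∑ p ∈ N, tr ((p : H →L[ℂ] H) * A) = tr A := by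
  obtain ⟨b, hb⟩ := hN.exists_orthonormalBasis
  rw [tr_eq_sum b, ← Finset.sum_coe_sort]
  refine Finset.sum_congr rfl fun p _ => ?_
  conv_lhs => rw [← hb p]
  rw [tr_rankOne_mul]
  rfl

theorem IsProjBasis.card_eq {N : Finset (PH H)} (hN : IsProjBasis (N : Set (PH H))) :
    N.card = Module.finrank ℂ H := by
  obtain ⟨b, -⟩ := hN.exists_orthonormalBasis
  rw [Module.finrank_eq_card_basis b.toBasis, Fintype.card_coe]

end Bases

/-! ### Observables of operators -/

section Observables

variable {H : Type*} [NormedAddCommGroup H] [InnerProductSpace ℂ H] [FiniteDimensional ℂ H]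

/-- Operators are determined by their expectation values in the pure states. -/
theorem eq_zero_of_tr_eq_zero {A : H →L[ℂ] H} (h : ∀ p : PH H, tr ((p : H →L[ℂ] H) * A) = 0) :
    A = 0 := by
  have h1 : ∀ x : H, ⟪A x, x⟫_ℂ = 0 := by
    intro x
    by_cases hx : x = 0
    · simp [hx]
    have hx' : (‖x‖ : ℂ) ≠ 0 := by simpa using hx
    have h2 := h (toProj ⟨(‖x‖⁻¹ : ℂ) • x, by simp [norm_smul, hx]⟩)
    rw [tr_rankOne_mul] at h2
    simp only [map_smul, inner_smul_left, inner_smul_right] at h2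
    have h3 : ⟪x, A x⟫_ℂ = 0 := by simpa [hx] using h2
    rw [← inner_conj_symm, h3, map_zero]
  have h2 := (inner_map_self_eq_zero (A : H →ₗ[ℂ] H)).mp h1
  ext x
  exact LinearMap.congr_fun h2 x

/-- `A ↦ tr A` as a continuous linear functional. -/
def trCLM : (H →L[ℂ] H) →L[ℂ] ℂ :=
  LinearMap.toContinuousLinearMap
    { toFun := tr, map_add' := tr_add, map_smul' := tr_smul }

theorem continuous_tr_mul (A : H →L[ℂ] H) :
    Continuous fun p : PH H => tr ((p : H →L[ℂ] H) * A) := by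
  have : Continuous fun p : PH H => trCLM ((p : H →L[ℂ] H) * A) := by fun_prop
  exact this

variable [CompleteSpace H]

theorem continuous_obs (κ : ℝ) (A : H →L[ℂ] H) : Continuous (obs κ A) := by
  have := continuous_tr_mul A
  unfold obs
  fun_prop

instance compactSpace_PH : CompactSpace (PH H) := by
  have : ProperSpace H := FiniteDimensional.proper_rclike ℂ H
  have h : range (toProj (H := H)) = univ := eq_univ_of_forall toProj_surjective
  exact ⟨h ▸ isCompact_range continuous_toProj⟩

theorem sum_obs (κ : ℝ) (A : H →L[ℂ] H) (hH : Module.finrank ℂ H ≠ 0) {N : Finset (PH H)}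
    (hN : IsProjBasis (N : Set (PH H))) : ∑ p ∈ N, obs κ A p = tr A := by
  have hn : (Module.finrank ℂ H : ℂ) ≠ 0 := by exact_mod_cast hH
  simp only [obs]
  rw [Finset.sum_add_distrib, ← Finset.mul_sum, hN.sum_tr, Finset.sum_const, hN.card_eq, nsmul_eq_mul]
  field_simp
  ring

theorem obs_mem_frameL2 (κ : ℝ) (A : H →L[ℂ] H) (hH : Module.finrank ℂ H ≠ 0) :
    obs κ A ∈ frameL2 H := by
  have : Nontrivial H := Module.nontrivial_of_finrank_pos (R := ℂ) (Nat.pos_of_ne_zero hH)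
  refine ⟨?_, tr A, fun N hN => sum_obs κ A hH hN⟩
  exact (continuous_obs κ A).memLp_of_hasCompactSupport (HasCompactSupport.of_compactSpace _)

theorem obs_sub (κ : ℝ) (A B : H →L[ℂ] H) (p : PH H) :
    obs κ (A - B) p = obs κ A p - obs κ B p := by
  simp only [obs, mul_sub, tr_sub]
  ring

theorem obs_injective {κ : ℝ} (hκ : κ ≠ 0) (hH : Module.finrank ℂ H ≠ 0) :
    Function.Injective (obs (H := H) κ) := by
  intro A B hAB
  have h0 : ∀ p, obs κ (A - B) p = 0 := fun p => by rw [obs_sub, hAB, sub_self]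
  have hn : (Module.finrank ℂ H : ℂ) ≠ 0 := by exact_mod_cast hH
  have hκ' : (κ : ℂ) ≠ 0 := by exact_mod_cast hκ
  have htr : tr (A - B) = 0 := by
    let b := stdOrthonormalBasis ℂ H
    have h1 : ∑ i, obs κ (A - B) (toProj (basisVec b i)) = tr (A - B) :=
      sum_frame_orthonormalBasis (fun N hN => sum_obs κ (A - B) hH hN) b
    rw [← h1]
    exact Finset.sum_eq_zero fun i _ => h0 _
  refine sub_eq_zero.mp (eq_zero_of_tr_eq_zero fun p => ?_)
  have := h0 p
  rw [obs, htr, mul_zero, add_zero] at this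
  exact (mul_eq_zero.mp this).resolve_left hκ'

theorem isSmooth_obs (κ : ℝ) (A : H →L[ℂ] H) : IsSmooth (obs κ A) := by
  have h : ContDiff ℝ ∞ fun X : H →L[ℂ] H =>
      (κ : ℂ) * trCLM (X * A) + ((1 - κ) / Module.finrank ℂ H) * tr A := by
    have h1 : ContDiff ℝ ∞ fun X : H →L[ℂ] H => trCLM (X * A) :=
      ((trCLM.comp ((ContinuousLinearMap.mul ℂ (H →L[ℂ] H)).flip A)).restrictScalars ℝ).contDiff
    fun_prop
  refine h.contDiffOn.congr fun X hX => ?_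
  exact Subtype.val_injective.extend_apply (obs κ A) 0 ⟨X, hX⟩

end Observables

/-! ### Fourth moments of the sphere -/

section SphereMoments

variable {H : Type*} [NormedAddCommGroup H] [InnerProductSpace ℂ H] [FiniteDimensional ℂ H]

/-- Two orthonormal systems of the same kind are related by a unitary operator. -/
theorem exists_unitary_of_orthonormal {ι : Type*} [Fintype ι] {v w : ι → H}
    (hv : Orthonormal ℂ v) (hw : Orthonormal ℂ w) : ∃ U : H ≃ₗᵢ[ℂ] H, ∀ i, U (v i) = w i := by
  let f : ι ↪ Fin (Module.finrank ℂ H) := (Fintype.equivFin ι).toEmbedding.trans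
    (Fin.castLEEmb hv.linearIndependent.fintype_card_le_finrank)
  have key : ∀ {u : ι → H}, Orthonormal ℂ u →
      ∃ b : OrthonormalBasis (Fin (Module.finrank ℂ H)) ℂ H, ∀ i, b (f i) = u i := by
    intro u hu
    have h1 : Orthonormal ℂ ((range f).domRestrict (Function.extend f u 0)) := by
      choose g hg using fun y : range f => y.2
      have hinj : Function.Injective g := fun y z h => Subtype.ext (by rw [← hg y, ← hg z, h])
      have h2 : (range f).domRestrict (Function.extend f u 0) = u ∘ g := by
        funext y
        change Function.extend f u 0 (y : Fin _) = u (g y)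
        conv_lhs => rw [← hg y]
        exact f.injective.extend_apply u 0 (g y)
      rw [h2]
      exact hu.comp g hinj
    obtain ⟨b, hb⟩ := h1.exists_orthonormalBasis_extension_of_card_eq (by simp)
    exact ⟨b, fun i => (hb (f i) ⟨i, rfl⟩).trans (f.injective.extend_apply u 0 i)⟩
  obtain ⟨b, hb⟩ := key hv
  obtain ⟨c, hc⟩ := key hw
  exact ⟨b.equiv c (Equiv.refl _), fun i => by rw [← hb i, ← hc i]; simp⟩

/-- The rotation-invariant probability measure on the unit sphere. It coincides with
`sphereMeasure`, but is stated for any Borel structure on `H`. -/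
def sphereProb (H : Type*) [NormedAddCommGroup H] [InnerProductSpace ℂ H] [FiniteDimensional ℂ H]
    [MeasurableSpace H] [BorelSpace H] : Measure (sphere (0 : H) 1) :=
  ((Measure.addHaar : Measure H).toSphere univ)⁻¹ • (Measure.addHaar : Measure H).toSphere

variable [MeasurableSpace H] [BorelSpace H]

theorem projMeasure_eq_map : projMeasure H = (sphereProb H).map toProj := by
  obtain rfl := BorelSpace.measurable_eq (α := H)
  rfl

instance sphereProb_isProbabilityMeasure [Nontrivial H] :
    IsProbabilityMeasure (sphereProb H) := by
  have h : IsProbabilityMeasure (projMeasure H) := inferInstance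
  rw [projMeasure_eq_map] at h
  exact (Measure.isProbabilityMeasure_map_iff continuous_toProj.measurable.aemeasurable).mp h

theorem measurePreserving_sphereAct (U : H ≃ₗᵢ[ℂ] H) :
    MeasurePreserving (sphereAct U) (sphereProb H) (sphereProb H) := by
  refine ⟨?_, ?_⟩
  · apply Continuous.measurable
    apply Continuous.subtype_mk
    fun_prop
  · obtain rfl := BorelSpace.measurable_eq (α := H)
    exact sphereMeasure_map U

theorem integral_projMeasure {f : PH H → ℂ} (hf : Continuous f) :
    ∫ p, f p ∂(projMeasure H) = ∫ x, f (toProj x) ∂(sphereProb H) := by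
  rw [projMeasure_eq_map, integral_map continuous_toProj.measurable.aemeasurable
    hf.aestronglyMeasurable]

theorem integrable_of_continuous_sphere [Nontrivial H] {E : Type*} [NormedAddCommGroup E]
    {f : sphere (0 : H) 1 → E} (hf : Continuous f) : Integrable f (sphereProb H) := by
  have : ProperSpace H := FiniteDimensional.proper_rclike ℂ H
  exact hf.integrable_of_hasCompactSupport (HasCompactSupport.of_compactSpace _)

theorem integral_comp_unitary {f : sphere (0 : H) 1 → ℝ} (hf : Continuous f) (U : H ≃ₗᵢ[ℂ] H) :
    ∫ x, f (sphereAct U x) ∂(sphereProb H) = ∫ x, f x ∂(sphereProb H) := by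
  have h := measurePreserving_sphereAct U
  conv_rhs => rw [← h.map_eq]
  rw [integral_map h.measurable.aemeasurable hf.aestronglyMeasurable]

/-- The mean of `|⟨e, x⟩|⁴` over the sphere does not depend on the unit vector `e`. -/
theorem integral_fourth_eq {e e' : H} (he : ‖e‖ = 1) (he' : ‖e'‖ = 1) :
    ∫ x : sphere (0 : H) 1, ‖⟪e, (x : H)⟫_ℂ‖ ^ 4 ∂(sphereProb H)
      = ∫ x : sphere (0 : H) 1, ‖⟪e', (x : H)⟫_ℂ‖ ^ 4 ∂(sphereProb H) := by
  obtain ⟨U, hU⟩ := exists_unitary_of_orthonormal (v := fun _ : Unit => e) (w := fun _ : Unit => e')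
    ⟨fun _ => he, fun i j h => (h (Subsingleton.elim i j)).elim⟩
    ⟨fun _ => he', fun i j h => (h (Subsingleton.elim i j)).elim⟩
  have hc : Continuous fun x : sphere (0 : H) 1 => ‖⟪e', (x : H)⟫_ℂ‖ ^ 4 := by fun_prop
  rw [← integral_comp_unitary hc U]
  congr 1
  ext x
  rw [← hU ()]
  simp only [sphereAct, LinearIsometryEquiv.inner_map_map]

theorem norm_add_pow_four (z w : ℂ) :
    ‖z + w‖ ^ 4 + ‖z - w‖ ^ 4 + ‖z + I * w‖ ^ 4 + ‖z - I * w‖ ^ 4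
      = 4 * ‖z‖ ^ 4 + 4 * ‖w‖ ^ 4 + 16 * (‖z‖ ^ 2 * ‖w‖ ^ 2) := by
  have h : ∀ u : ℂ, ‖u‖ ^ 4 = (u.re ^ 2 + u.im ^ 2) ^ 2 := by
    intro u
    rw [← normSq_add_mul_I, re_add_im, normSq_eq_norm_sq]
    ring
  have h2 : ∀ u : ℂ, ‖u‖ ^ 2 = u.re ^ 2 + u.im ^ 2 := by
    intro u
    rw [← normSq_add_mul_I, re_add_im, normSq_eq_norm_sq]
  simp only [h, h2, add_re, add_im, sub_re, sub_im, mul_re, mul_im, I_re, I_im]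
  ring

/-- For orthonormal `e` and `e'`, the function `|⟨e, x⟩|² |⟨e', x⟩|²` has half the mean of
`|⟨e, x⟩|⁴`: average the fourth powers for the vectors `e + iᵏ e'`. -/
theorem integral_mul_eq_half {e e' : H} [Nontrivial H] (he : ‖e‖ = 1) (he' : ‖e'‖ = 1)
    (h : ⟪e, e'⟫_ℂ = 0) :
    ∫ x : sphere (0 : H) 1, ‖⟪e, (x : H)⟫_ℂ‖ ^ 2 * ‖⟪e', (x : H)⟫_ℂ‖ ^ 2 ∂(sphereProb H)
      = (∫ x : sphere (0 : H) 1, ‖⟪e, (x : H)⟫_ℂ‖ ^ 4 ∂(sphereProb H)) / 2 := by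
  set α := ∫ x : sphere (0 : H) 1, ‖⟪e, (x : H)⟫_ℂ‖ ^ 4 ∂(sphereProb H) with hα
  have key : ∀ c : ℂ, ‖c‖ = 1 →
      ∫ x : sphere (0 : H) 1, ‖⟪e + c • e', (x : H)⟫_ℂ‖ ^ 4 ∂(sphereProb H) = 4 * α := by
    intro c hc
    have hn : ‖e + c • e'‖ ^ 2 = 2 := by
      have := norm_add_sq_eq_norm_sq_add_norm_sq_of_inner_eq_zero e (c • e')
        (by rw [inner_smul_right, h, mul_zero])
      rw [sq, this, norm_smul, he, he', hc]; norm_num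
    have hn0 : ‖e + c • e'‖ ≠ 0 := by
      intro h0; rw [h0] at hn; norm_num at hn
    have hu : ‖(‖e + c • e'‖⁻¹ : ℂ) • (e + c • e')‖ = 1 := by
      rw [norm_smul, norm_inv, norm_real, norm_norm, inv_mul_cancel₀ hn0]
    rw [hα, ← integral_fourth_eq hu he, ← integral_const_mul]
    congr 1
    ext x
    rw [inner_smul_left, norm_mul, mul_pow, RCLike.norm_conj, norm_inv, norm_real, norm_norm,
      inv_pow]
    have : ‖e + c • e'‖ ^ 4 = 4 := by
      calc ‖e + c • e'‖ ^ 4 = (‖e + c • e'‖ ^ 2) ^ 2 := by ring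
        _ = 4 := by rw [hn]; norm_num
    rw [this]
    ring
  have hint : ∀ c : ℂ, Integrable (fun x : sphere (0 : H) 1 => ‖⟪e + c • e', (x : H)⟫_ℂ‖ ^ 4)
      (sphereProb H) := fun c => integrable_of_continuous_sphere (by fun_prop)
  have h1 : ∫ x : sphere (0 : H) 1, (‖⟪e + (1 : ℂ) • e', (x : H)⟫_ℂ‖ ^ 4
      + ‖⟪e + (-1 : ℂ) • e', (x : H)⟫_ℂ‖ ^ 4 + ‖⟪e + (-I) • e', (x : H)⟫_ℂ‖ ^ 4
      + ‖⟪e + I • e', (x : H)⟫_ℂ‖ ^ 4) ∂(sphereProb H) = 16 * α := by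
    have h2 : ∀ c d : ℂ, Integrable (fun x : sphere (0 : H) 1 =>
        ‖⟪e + c • e', (x : H)⟫_ℂ‖ ^ 4 + ‖⟪e + d • e', (x : H)⟫_ℂ‖ ^ 4) (sphereProb H) :=
      fun c d => (hint c).add (hint d)
    have h3 : ∀ c d k : ℂ, Integrable (fun x : sphere (0 : H) 1 =>
        ‖⟪e + c • e', (x : H)⟫_ℂ‖ ^ 4 + ‖⟪e + d • e', (x : H)⟫_ℂ‖ ^ 4
          + ‖⟪e + k • e', (x : H)⟫_ℂ‖ ^ 4) (sphereProb H) :=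
      fun c d k => (h2 c d).add (hint k)
    rw [integral_add (h3 _ _ _) (hint _), integral_add (h2 _ _) (hint _),
      integral_add (hint _) (hint _),
      key 1 (by simp), key (-1) (by simp), key (-I) (by simp), key I (by simp)]
    ring
  have h2 : ∀ x : sphere (0 : H) 1, ‖⟪e + (1 : ℂ) • e', (x : H)⟫_ℂ‖ ^ 4
      + ‖⟪e + (-1 : ℂ) • e', (x : H)⟫_ℂ‖ ^ 4 + ‖⟪e + (-I) • e', (x : H)⟫_ℂ‖ ^ 4
      + ‖⟪e + I • e', (x : H)⟫_ℂ‖ ^ 4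
      = 4 * ‖⟪e, (x : H)⟫_ℂ‖ ^ 4 + 4 * ‖⟪e', (x : H)⟫_ℂ‖ ^ 4
        + 16 * (‖⟪e, (x : H)⟫_ℂ‖ ^ 2 * ‖⟪e', (x : H)⟫_ℂ‖ ^ 2) := by
    intro x
    rw [← norm_add_pow_four]
    simp only [inner_add_left, inner_smul_left, map_neg, map_one, conj_I, neg_neg, one_mul,
      neg_mul, sub_eq_add_neg]
  have hi1 : Integrable (fun x : sphere (0 : H) 1 => 4 * ‖⟪e, (x : H)⟫_ℂ‖ ^ 4) (sphereProb H) :=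
    integrable_of_continuous_sphere (by fun_prop)
  have hi2 : Integrable (fun x : sphere (0 : H) 1 => 4 * ‖⟪e', (x : H)⟫_ℂ‖ ^ 4) (sphereProb H) :=
    integrable_of_continuous_sphere (by fun_prop)
  have hi3 : Integrable (fun x : sphere (0 : H) 1 =>
      16 * (‖⟪e, (x : H)⟫_ℂ‖ ^ 2 * ‖⟪e', (x : H)⟫_ℂ‖ ^ 2)) (sphereProb H) :=
    integrable_of_continuous_sphere (by fun_prop)
  have hi4 : Integrable (fun x : sphere (0 : H) 1 =>
      4 * ‖⟪e, (x : H)⟫_ℂ‖ ^ 4 + 4 * ‖⟪e', (x : H)⟫_ℂ‖ ^ 4) (sphereProb H) := hi1.add hi2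
  simp_rw [h2] at h1
  rw [integral_add hi4 hi3, integral_add hi1 hi2, integral_const_mul,
    integral_const_mul, integral_const_mul, integral_fourth_eq he' he, ← hα] at h1
  linarith

theorem sum_norm_inner_sq {ι : Type*} [Fintype ι] (b : OrthonormalBasis ι ℂ H)
    (x : sphere (0 : H) 1) : ∑ i, ‖⟪b i, (x : H)⟫_ℂ‖ ^ 2 = 1 := by
  rw [b.sum_sq_norm_inner_right]
  simp

theorem integral_sq [Nontrivial H] {ι : Type*} [Fintype ι] (b : OrthonormalBasis ι ℂ H) (i : ι) :
    ∫ x : sphere (0 : H) 1, ‖⟪b i, (x : H)⟫_ℂ‖ ^ 2 ∂(sphereProb H)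
      = (Fintype.card ι + 1) / 2 * ∫ x : sphere (0 : H) 1, ‖⟪b i, (x : H)⟫_ℂ‖ ^ 4 ∂(sphereProb H) := by
  classical
  have h1 : ∀ x : sphere (0 : H) 1, ‖⟪b i, (x : H)⟫_ℂ‖ ^ 2
      = ∑ j, ‖⟪b i, (x : H)⟫_ℂ‖ ^ 2 * ‖⟪b j, (x : H)⟫_ℂ‖ ^ 2 := fun x => by
    rw [← Finset.mul_sum, sum_norm_inner_sq, mul_one]
  rw [integral_congr_ae (Filter.Eventually.of_forall h1),
    integral_finsetSum _ fun j _ => integrable_of_continuous_sphere (by fun_prop),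
    ← Finset.add_sum_erase _ _ (Finset.mem_univ i)]
  have h2 : ∀ j ∈ Finset.univ.erase i,
      ∫ x : sphere (0 : H) 1, ‖⟪b i, (x : H)⟫_ℂ‖ ^ 2 * ‖⟪b j, (x : H)⟫_ℂ‖ ^ 2 ∂(sphereProb H)
      = (∫ x : sphere (0 : H) 1, ‖⟪b i, (x : H)⟫_ℂ‖ ^ 4 ∂(sphereProb H)) / 2 := fun j hj =>
    integral_mul_eq_half (by simp) (by simp) (b.orthonormal.2 (Finset.ne_of_mem_erase hj).symm)
  rw [Finset.sum_congr rfl h2, Finset.sum_const, Finset.card_erase_of_mem (Finset.mem_univ i),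
    Finset.card_univ, nsmul_eq_mul, Nat.cast_sub (Fintype.card_pos_iff.mpr ⟨i⟩)]
  have h3 : ∀ x : sphere (0 : H) 1, ‖⟪b i, (x : H)⟫_ℂ‖ ^ 2 * ‖⟪b i, (x : H)⟫_ℂ‖ ^ 2
      = ‖⟪b i, (x : H)⟫_ℂ‖ ^ 4 := fun x => by ring
  simp_rw [h3]
  push_cast
  ring

theorem integral_fourth [Nontrivial H] {ι : Type*} [Fintype ι] (b : OrthonormalBasis ι ℂ H)
    (i : ι) :
    ∫ x : sphere (0 : H) 1, ‖⟪b i, (x : H)⟫_ℂ‖ ^ 4 ∂(sphereProb H)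
      = 2 / (Fintype.card ι * (Fintype.card ι + 1)) := by
  have h1 : ∑ j, ∫ x : sphere (0 : H) 1, ‖⟪b j, (x : H)⟫_ℂ‖ ^ 2 ∂(sphereProb H) = 1 := by
    rw [← integral_finsetSum _ fun j _ => integrable_of_continuous_sphere (by fun_prop)]
    simp_rw [sum_norm_inner_sq]
    simp
  have h2 : ∀ j, ∫ x : sphere (0 : H) 1, ‖⟪b j, (x : H)⟫_ℂ‖ ^ 2 ∂(sphereProb H)
      = (Fintype.card ι + 1) / 2 *
        ∫ x : sphere (0 : H) 1, ‖⟪b i, (x : H)⟫_ℂ‖ ^ 4 ∂(sphereProb H) := fun j => by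
    rw [integral_sq, integral_fourth_eq (e := b j) (e' := b i) (by simp) (by simp)]
  simp_rw [h2] at h1
  rw [Finset.sum_const, Finset.card_univ, nsmul_eq_mul] at h1
  have hc : (0 : ℝ) < Fintype.card ι := by exact_mod_cast Fintype.card_pos_iff.mpr ⟨i⟩
  rw [eq_div_iff (by positivity)]
  linarith

end SphereMoments

/-! ### Second moments of expectation values -/

section OperatorMoments

variable {H : Type*} [NormedAddCommGroup H] [InnerProductSpace ℂ H] [FiniteDimensional ℂ H]

/-- The mean of the product of the expectation values of two operators. -/
def secondMoment (A B : H →L[ℂ] H) : ℂ :=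
  ∫ p : PH H, tr ((p : H →L[ℂ] H) * A) * tr ((p : H →L[ℂ] H) * B) ∂(projMeasure H)

theorem integrable_of_continuous_PH [Nontrivial H] {E : Type*} [NormedAddCommGroup E]
    {f : PH H → E} (hf : Continuous f) : Integrable f (projMeasure H) := by
  have : CompleteSpace H := FiniteDimensional.complete ℂ H
  exact hf.integrable_of_hasCompactSupport (HasCompactSupport.of_compactSpace _)

theorem secondMoment_comm (A B : H →L[ℂ] H) : secondMoment A B = secondMoment B A := by
  simp only [secondMoment, mul_comm]

theorem secondMoment_add_left [Nontrivial H] (A B C : H →L[ℂ] H) :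
    secondMoment (A + B) C = secondMoment A C + secondMoment B C := by
  have hA := continuous_tr_mul A
  have hB := continuous_tr_mul B
  have hC := continuous_tr_mul C
  simp only [secondMoment, mul_add, tr_add, add_mul]
  exact integral_add (integrable_of_continuous_PH (hA.mul hC))
    (integrable_of_continuous_PH (hB.mul hC))

theorem secondMoment_smul_left (c : ℂ) (A B : H →L[ℂ] H) :
    secondMoment (c • A) B = c * secondMoment A B := by
  simp only [secondMoment, mul_smul_comm, tr_smul, mul_assoc]
  exact integral_const_mul _ _

theorem secondMoment_add_right [Nontrivial H] (A B C : H →L[ℂ] H) :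
    secondMoment A (B + C) = secondMoment A B + secondMoment A C := by
  rw [secondMoment_comm, secondMoment_add_left, secondMoment_comm B, secondMoment_comm C]

theorem secondMoment_smul_right (c : ℂ) (A B : H →L[ℂ] H) :
    secondMoment A (c • B) = c * secondMoment A B := by
  rw [secondMoment_comm, secondMoment_smul_left, secondMoment_comm]

theorem secondMoment_self [Nontrivial H] [CompleteSpace H] {A : H →L[ℂ] H}
    (hA : IsSelfAdjoint A) : secondMoment A A
      = (tr A * tr A + tr (A * A)) / (Module.finrank ℂ H * (Module.finrank ℂ H + 1)) := by
  classical
  let _ : MeasurableSpace H := borel H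
  have : BorelSpace H := ⟨rfl⟩
  have hs : (A : H →ₗ[ℂ] H).IsSymmetric := hA.isSymmetric
  obtain ⟨n, hn⟩ : ∃ n, Module.finrank ℂ H = n := ⟨_, rfl⟩
  let b := hs.eigenvectorBasis hn
  let a := hs.eigenvalues hn
  have hb : ∀ i, A (b i) = (a i : ℂ) • b i := fun i => hs.apply_eigenvectorBasis hn i
  have htr : tr A = ((∑ i, a i : ℝ) : ℂ) := by
    rw [tr_eq_sum b]
    push_cast
    refine Finset.sum_congr rfl fun i _ => ?_
    rw [hb, inner_smul_right]
    simp
  have htr2 : tr (A * A) = ((∑ i, a i ^ 2 : ℝ) : ℂ) := by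
    rw [tr_eq_sum b]
    push_cast
    refine Finset.sum_congr rfl fun i _ => ?_
    change ⟪b i, A (A (b i))⟫_ℂ = _
    rw [hb, map_smul, hb, inner_smul_right, inner_smul_right]
    simp [sq]
  have hexp : ∀ x : sphere (0 : H) 1, tr ((toProj x : H →L[ℂ] H) * A)
      = ((∑ i, a i * ‖⟪b i, (x : H)⟫_ℂ‖ ^ 2 : ℝ) : ℂ) := by
    intro x
    rw [tr_rankOne_mul, ← b.sum_inner_mul_inner]
    push_cast
    refine Finset.sum_congr rfl fun i _ => ?_
    have h1 : ⟪b i, A x⟫_ℂ = a i * ⟪b i, (x : H)⟫_ℂ := by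
      have := hs (b i) x
      change ⟪A (b i), (x : H)⟫_ℂ = ⟪b i, A x⟫_ℂ at this
      rw [← this, hb, inner_smul_left, conj_ofReal]
    have h2 : ⟪(x : H), b i⟫_ℂ * ⟪b i, (x : H)⟫_ℂ = (‖⟪b i, (x : H)⟫_ℂ‖ : ℂ) ^ 2 := by
      rw [← inner_conj_symm, ← normSq_eq_conj_mul_self, normSq_eq_norm_sq]
      push_cast
      rfl
    rw [h1, ← h2]
    ring
  have hα : ∀ i j, ∫ x : sphere (0 : H) 1, ‖⟪b i, (x : H)⟫_ℂ‖ ^ 2 * ‖⟪b j, (x : H)⟫_ℂ‖ ^ 2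
      ∂(sphereProb H) = (1 + if i = j then 1 else 0) / (n * (n + 1)) := by
    intro i j
    have h4 := integral_fourth b i
    rw [Fintype.card_fin] at h4
    split_ifs with hij
    · subst hij
      have h3 : ∀ x : sphere (0 : H) 1, ‖⟪b i, (x : H)⟫_ℂ‖ ^ 2 * ‖⟪b i, (x : H)⟫_ℂ‖ ^ 2
          = ‖⟪b i, (x : H)⟫_ℂ‖ ^ 4 := fun x => by ring
      simp_rw [h3]
      rw [h4]
      norm_num
    · rw [integral_mul_eq_half (by simp) (by simp) (b.orthonormal.2 hij), h4]
      ring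
  have hc : Continuous fun p : PH H => tr ((p : H →L[ℂ] H) * A) * tr ((p : H →L[ℂ] H) * A) :=
    (continuous_tr_mul A).mul (continuous_tr_mul A)
  rw [secondMoment, integral_projMeasure hc]
  simp_rw [hexp, ← ofReal_mul]
  rw [integral_complex_ofReal, htr, htr2, hn]
  have h5 : ∀ x : sphere (0 : H) 1, (∑ i, a i * ‖⟪b i, (x : H)⟫_ℂ‖ ^ 2)
      * (∑ i, a i * ‖⟪b i, (x : H)⟫_ℂ‖ ^ 2)
      = ∑ i, ∑ j, a i * a j * (‖⟪b i, (x : H)⟫_ℂ‖ ^ 2 * ‖⟪b j, (x : H)⟫_ℂ‖ ^ 2) := by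
    intro x
    rw [Finset.sum_mul_sum]
    refine Finset.sum_congr rfl fun i _ => Finset.sum_congr rfl fun j _ => by ring
  simp_rw [h5]
  rw [integral_finsetSum _ fun i _ => integrable_of_continuous_sphere (by fun_prop)]
  have h6 : ∀ i, ∫ x : sphere (0 : H) 1, ∑ j, a i * a j *
      (‖⟪b i, (x : H)⟫_ℂ‖ ^ 2 * ‖⟪b j, (x : H)⟫_ℂ‖ ^ 2) ∂(sphereProb H)
      = (a i * (∑ j, a j) + a i ^ 2) / (n * (n + 1)) := by
    intro i
    rw [integral_finsetSum _ fun j _ => integrable_of_continuous_sphere (by fun_prop)]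
    simp_rw [integral_const_mul, hα, mul_div_assoc', mul_add, mul_one, mul_ite, mul_zero, mul_one]
    rw [← Finset.sum_div, Finset.sum_add_distrib, Finset.sum_ite_eq, if_pos (Finset.mem_univ i),
      Finset.mul_sum, sq]
  simp_rw [h6]
  rw [← Finset.sum_div, Finset.sum_add_distrib, ← Finset.sum_mul]
  push_cast
  ring

/-- The second moments of the invariant measure, by polarisation of `secondMoment_self`. -/
theorem secondMoment_eq [Nontrivial H] [CompleteSpace H] (A B : H →L[ℂ] H) : secondMoment A B
      = (tr A * tr B + tr (A * B)) / (Module.finrank ℂ H * (Module.finrank ℂ H + 1)) := by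
  have hsa : ∀ {A B : H →L[ℂ] H}, IsSelfAdjoint A → IsSelfAdjoint B → secondMoment A B
      = (tr A * tr B + tr (A * B)) / (Module.finrank ℂ H * (Module.finrank ℂ H + 1)) := by
    intro A B hA hB
    have h1 := secondMoment_self (hA.add hB)
    rw [secondMoment_add_left, secondMoment_add_right, secondMoment_add_right,
      secondMoment_comm B A, secondMoment_self hA, secondMoment_self hB] at h1
    simp only [add_mul, mul_add, tr_add, tr_mul_comm B A] at h1
    linear_combination h1 / 2
  have hreal : ∀ {A : H →L[ℂ] H}, IsSelfAdjoint A → ∀ B, secondMoment A B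
      = (tr A * tr B + tr (A * B)) / (Module.finrank ℂ H * (Module.finrank ℂ H + 1)) := by
    intro A hA B
    obtain ⟨C, hC, D, hD, rfl⟩ : ∃ C, IsSelfAdjoint C ∧ ∃ D, IsSelfAdjoint D ∧ B = C + I • D :=
      ⟨_, (realPart B).2, _, (imaginaryPart B).2, (realPart_add_I_smul_imaginaryPart B).symm⟩
    rw [secondMoment_add_right, secondMoment_smul_right, hsa hA hC, hsa hA hD, tr_add, tr_smul,
      mul_add A, mul_smul_comm, tr_add, tr_smul]
    ring
  obtain ⟨C, hC, D, hD, rfl⟩ : ∃ C, IsSelfAdjoint C ∧ ∃ D, IsSelfAdjoint D ∧ A = C + I • D :=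
    ⟨_, (realPart A).2, _, (imaginaryPart A).2, (realPart_add_I_smul_imaginaryPart A).symm⟩
  rw [secondMoment_add_left, secondMoment_smul_left, hreal hC, hreal hD, tr_add, tr_smul,
    add_mul C, smul_mul_assoc, tr_add, tr_smul]
  ring

theorem integral_tr [Nontrivial H] [CompleteSpace H] (A : H →L[ℂ] H) :
    ∫ p : PH H, tr ((p : H →L[ℂ] H) * A) ∂(projMeasure H) = tr A / Module.finrank ℂ H := by
  have h := secondMoment_eq A 1
  have h1 : tr (1 : H →L[ℂ] H) = Module.finrank ℂ H := LinearMap.trace_one ℂ H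
  have hn : (Module.finrank ℂ H : ℂ) ≠ 0 := by
    exact_mod_cast (Module.finrank_pos (R := ℂ) (M := H)).ne'
  have hn1 : (Module.finrank ℂ H : ℂ) + 1 ≠ 0 := by
    exact_mod_cast Nat.succ_ne_zero (Module.finrank ℂ H)
  simp only [secondMoment, mul_one, tr_coe, h1] at h
  rw [h]
  field_simp

end OperatorMoments

/-! ### Derivatives of affine functions along the projective space -/

section Derivatives

variable {H : Type*} [NormedAddCommGroup H] [InnerProductSpace ℂ H] [CompleteSpace H]

theorem unitary_conj_mem_projSpace {U p : H →L[ℂ] H} (hU : star U * U = 1)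
    (hp : p ∈ projSpace H) : U * p * star U ∈ projSpace H := by
  obtain ⟨ψ, hψ, rfl⟩ := hp
  refine ⟨U ψ, ?_, ?_⟩
  · have h1 : ⟪U ψ, U ψ⟫_ℂ = ⟪ψ, ψ⟫_ℂ := by
      rw [← ContinuousLinearMap.adjoint_inner_right, ← ContinuousLinearMap.star_eq_adjoint]
      change ⟪ψ, (star U * U) ψ⟫_ℂ = _
      rw [hU]
      rfl
    rw [inner_self_eq_norm_sq_to_K, inner_self_eq_norm_sq_to_K, hψ] at h1
    have h2 : ‖U ψ‖ ^ 2 = 1 ^ 2 := by exact_mod_cast h1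
    exact (pow_left_inj₀ (norm_nonneg _) zero_le_one two_ne_zero).mp h2
  · ext x
    change U (⟪ψ, star U x⟫_ℂ • ψ) = ⟪U ψ, x⟫_ℂ • U ψ
    rw [map_smul, ContinuousLinearMap.star_eq_adjoint, ContinuousLinearMap.adjoint_inner_right]

/-- Every tangent vector is the velocity of a curve in the projective space, namely of
`t ↦ exp (-itA) p exp (itA)`. -/
theorem exists_curve (p : PH H) (v : tangent p) : ∃ γ : ℝ → (H →L[ℂ] H), γ 0 = p ∧
    (∀ t, γ t ∈ projSpace H) ∧ HasDerivAt γ (v : H →L[ℂ] H) 0 := by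
  obtain ⟨_, A, hA, rfl⟩ := v
  let T : H →L[ℂ] H := (-I) • A
  have hT : star T = -T := by
    have hA' : star A = A := hA
    simp [T, star_smul, hA']
  have hstar : ∀ t : ℝ, star (NormedSpace.exp (t • T)) = NormedSpace.exp (t • (-T)) := by
    intro t
    rw [NormedSpace.star_exp, star_smul, hT, star_trivial]
  refine ⟨fun t => NormedSpace.exp (t • T) * p * NormedSpace.exp (t • (-T)), ?_, ?_, ?_⟩
  · simp
  · intro t
    have h := unitary_conj_mem_projSpace (U := NormedSpace.exp (t • T)) ?_ p.2
    · rwa [hstar] at h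
    · rw [hstar, smul_neg]
      let +nondep : NormedAlgebra ℚ (H →L[ℂ] H) := .restrictScalars ℚ ℂ _
      rw [← NormedSpace.exp_add_of_commute (Commute.neg_left (Commute.refl _)), neg_add_cancel,
        NormedSpace.exp_zero]
  · have h1 := hasDerivAt_exp_smul_const (𝕂 := ℝ) T 0
    have h2 := hasDerivAt_exp_smul_const (𝕂 := ℝ) (-T) 0
    have h3 := (h1.mul_const (p : H →L[ℂ] H)).mul h2
    refine h3.congr_deriv ?_
    simp only [zero_smul, NormedSpace.exp_zero, one_mul, mul_one, comm, T, mul_neg,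
      smul_mul_assoc, mul_smul_comm]
    rw [smul_sub, sub_eq_add_neg]

/-- The differential of the restriction of a real affine function to the projective space. Since
`fderivWithin` is not unique, it is only determined on velocities of curves. -/
theorem differential_of_affine {f : PH H → ℝ} (L : (H →L[ℂ] H) →L[ℝ] ℝ) (c : ℝ)
    (hf : ∀ p : PH H, f p = L p + c) (p : PH H) (v : tangent p) :
    differential f p v = L v := by
  have h1 : HasFDerivWithinAt (Function.extend Subtype.val f 0) L (projSpace H) p := by
    have h2 : HasFDerivWithinAt (fun X => L X + c) L (projSpace H) p :=
      (L.hasFDerivAt.add_const c).hasFDerivWithinAt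
    refine h2.congr (fun X hX => ?_) ?_
    · exact (Subtype.val_injective.extend_apply f 0 ⟨X, hX⟩).trans (hf _)
    · exact (Subtype.val_injective.extend_apply f 0 p).trans (hf _)
  obtain ⟨γ, h0, hγ, hd⟩ := exists_curve p v
  have h3 := h1.differentiableWithinAt.hasFDerivWithinAt
  have key : ∀ D : (H →L[ℂ] H) →L[ℝ] ℝ,
      HasFDerivWithinAt (Function.extend Subtype.val f 0) D (projSpace H) p →
      HasDerivAt (Function.extend Subtype.val f 0 ∘ γ) (D v) 0 := fun D hD =>
    HasFDerivWithinAt.comp_hasDerivAt (t := projSpace H) 0 (by rwa [h0]) hd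
      (Filter.Eventually.of_forall hγ)
  exact (key _ h3).unique (key _ h1)

end Derivatives

/-! ### Poisson bracket, gradient product and the product formula -/

section Brackets

variable {H : Type*} [NormedAddCommGroup H] [InnerProductSpace ℂ H] [CompleteSpace H]
  [FiniteDimensional ℂ H]

theorem differential_re_obs (κ : ℝ) (A : H →L[ℂ] H) (p : PH H) (v : tangent p) :
    differential (fun q => (obs κ A q).re) p v = (κ * tr ((v : H →L[ℂ] H) * A)).re := by
  let L : (H →L[ℂ] H) →L[ℝ] ℝ := reCLM.comp
    (((κ : ℂ) • trCLM.comp ((ContinuousLinearMap.mul ℂ (H →L[ℂ] H)).flip A)).restrictScalars ℝ)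
  exact differential_of_affine L (((1 - κ) / Module.finrank ℂ H) * tr A).re
    (fun q => by rw [obs, add_re]; rfl) p v

theorem tr_cycle (A B C : H →L[ℂ] H) : tr (A * B * C) = tr (B * C * A) := by
  rw [mul_assoc, tr_mul_comm]

theorem tr_comm_mul (p : PH H) (A B : H →L[ℂ] H) :
    tr (comm B p * A) = tr ((p : H →L[ℂ] H) * (A * B)) - tr ((p : H →L[ℂ] H) * (B * A)) := by
  rw [comm, sub_mul, tr_sub, tr_cycle, mul_assoc, mul_assoc]

theorem tr_sandwich_mul (p : PH H) (A B : H →L[ℂ] H) :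
    tr ((p : H →L[ℂ] H) * A * (p : H →L[ℂ] H) * B) = tr ((p : H →L[ℂ] H) * A) * tr ((p : H →L[ℂ] H) * B) := by
  rw [p.sandwich, smul_mul_assoc, tr_smul]

/-- The Hamiltonian field of the observable of the self-adjoint operator `A` is `-i[A, p]`. -/
theorem hamField_obs {κ : ℝ} (hκ : 0 < κ) {A : H →L[ℂ] H} (hA : IsSelfAdjoint A) (p : PH H) :
    hamField hκ (fun q => (obs κ A q).re) p = ⟨_, lie_mem_tangent p hA⟩ := by
  rw [hamField, LinearEquiv.symm_apply_eq]
  ext ⟨_, B, hB, rfl⟩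
  rw [differential_re_obs, LinearMap.BilinForm.toDual_def, ← ofReal_re (omega κ p _ _),
    omega_gen κ p hA hB, omegaOp, smul_mul_assoc, tr_smul, tr_comm_mul, comm,
    mul_sub (p : H →L[ℂ] H), tr_sub]
  congr 1
  ring

/-- The Poisson bracket is `-iκ tr (p [A, B])`. -/
theorem poissonReal_obs {κ : ℝ} (hκ : 0 < κ) {A B : H →L[ℂ] H} (hA : IsSelfAdjoint A)
    (hB : IsSelfAdjoint B) (p : PH H) :
    (poissonReal hκ (fun q => (obs κ A q).re) (fun q => (obs κ B q).re) p : ℂ)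
      = -(I * κ) * (tr ((p : H →L[ℂ] H) * (A * B)) - tr ((p : H →L[ℂ] H) * (B * A))) := by
  rw [poissonReal, hamField_obs hκ hA, hamField_obs hκ hB, omega_gen κ p hA hB, omegaOp, comm,
    mul_sub, tr_sub]

theorem isSelfAdjoint_I_smul_comm (p : PH H) {A : H →L[ℂ] H} (hA : IsSelfAdjoint A) :
    IsSelfAdjoint (I • comm A (p : H →L[ℂ] H)) := by
  have h := tangent_sa ⟨_, lie_mem_tangent p hA⟩
  have h2 : I • comm A (p : H →L[ℂ] H) = -((-I) • comm A (p : H →L[ℂ] H)) := by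
    rw [neg_smul, neg_neg]
  change star _ = _
  rw [h2, star_neg, h]

/-- The gradient of the observable of the self-adjoint operator `A` is `[[A, p], p]`, the tangent
vector generated by `i[A, p]`. -/
theorem gradient_obs {κ : ℝ} (hκ : 0 < κ) {A : H →L[ℂ] H} (hA : IsSelfAdjoint A) (p : PH H) :
    ((metric κ p).toDual (metric_nondegenerate hκ p)).symm
      (differential (fun q => (obs κ A q).re) p)
      = ⟨_, lie_mem_tangent p (isSelfAdjoint_I_smul_comm p hA)⟩ := by
  rw [LinearEquiv.symm_apply_eq]
  ext ⟨_, B, hB, rfl⟩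
  have hp := p.idem
  have h1 : tr ((p : H →L[ℂ] H) * (comm A p * B))
      = tr ((p : H →L[ℂ] H) * A) * tr ((p : H →L[ℂ] H) * B) - tr ((p : H →L[ℂ] H) * (A * B)) := by
    rw [← tr_sandwich_mul, ← tr_sub]
    congr 1
    rw [comm, sub_mul, mul_sub, ← mul_assoc (p : H →L[ℂ] H) (p * A) B,
      ← mul_assoc (p : H →L[ℂ] H) p A, hp]
    noncomm_ring
  have h2 : tr ((p : H →L[ℂ] H) * (B * comm A p))
      = tr ((p : H →L[ℂ] H) * (B * A)) - tr ((p : H →L[ℂ] H) * A) * tr ((p : H →L[ℂ] H) * B) := by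
    rw [mul_comm (tr _), ← tr_sandwich_mul]
    have h3 : tr ((p : H →L[ℂ] H) * (B * A)) = tr ((p : H →L[ℂ] H) * (B * A) * (p : H →L[ℂ] H)) := by
      rw [tr_mul_comm _ (p : H →L[ℂ] H), ← mul_assoc (p : H →L[ℂ] H) p, hp]
    rw [h3, ← tr_sub, comm]
    congr 1
    noncomm_ring
  have h4 : tr ((p : H →L[ℂ] H) * comm A p) = 0 := by
    rw [comm, mul_sub, tr_sub, tr_mul_comm (p : H →L[ℂ] H) (A * p), mul_assoc,
      ← mul_assoc (p : H →L[ℂ] H) p A, hp, tr_mul_comm, sub_self]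
  have h5 : metricOp κ p (I • comm A p) B
      = -(I * κ) * (tr ((p : H →L[ℂ] H) * (A * B)) - tr ((p : H →L[ℂ] H) * (B * A))) := by
    have h6 : metricOp κ p (I • comm A p) B = κ * tr ((p : H →L[ℂ] H) *
        (((-I) • comm (I • comm A p) p) * ((-I) • comm B p)
        + ((-I) • comm B p) * ((-I) • comm (I • comm A p) p))) := by
      simp only [metricOp, smul_mul_assoc, mul_smul_comm, smul_smul, ← smul_add, tr_smul]
      linear_combination (-κ * tr ((p : H →L[ℂ] H) * (comm (I • comm A p) p * comm B p
        + comm B p * comm (I • comm A p) p))) * I_mul_I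
    rw [h6, mul_add, tr_add, tr_generated, tr_generated, smul_mul_assoc, mul_smul_comm,
      mul_smul_comm, mul_smul_comm, mul_smul_comm, tr_smul, tr_smul, tr_smul, h1, h2, h4]
    ring
  rw [differential_re_obs, LinearMap.BilinForm.toDual_def, ← ofReal_re (metric κ p _ _),
    metric_gen κ p (isSelfAdjoint_I_smul_comm p hA) hB, h5, smul_mul_assoc, tr_smul, tr_comm_mul]
  congr 1
  ring

/-- The scalar product of the differentials is `κ (tr (p (AB + BA)) - 2 tr (pA) tr (pB))`. -/
theorem coMetric_obs {κ : ℝ} (hκ : 0 < κ) {A B : H →L[ℂ] H} (hA : IsSelfAdjoint A)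
    (hB : IsSelfAdjoint B) (p : PH H) :
    (coMetric hκ p (differential (fun q => (obs κ A q).re) p)
        (differential (fun q => (obs κ B q).re) p) : ℂ)
      = κ * (tr ((p : H →L[ℂ] H) * (A * B)) + tr ((p : H →L[ℂ] H) * (B * A))
        - 2 * (tr ((p : H →L[ℂ] H) * A) * tr ((p : H →L[ℂ] H) * B))) := by
  have hp := p.idem
  have h1 : coMetric hκ p (differential (fun q => (obs κ A q).re) p)
      (differential (fun q => (obs κ B q).re) p)
      = differential (fun q => (obs κ A q).re) p
        ⟨_, lie_mem_tangent p (isSelfAdjoint_I_smul_comm p hB)⟩ := by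
    rw [coMetric, gradient_obs hκ hB, ← LinearMap.BilinForm.toDual_def
      (metric_nondegenerate hκ p), LinearEquiv.apply_symm_apply]
  have h2 : tr (((-I) • comm (I • comm B p) p) * A)
      = tr ((p : H →L[ℂ] H) * (A * B)) + tr ((p : H →L[ℂ] H) * (B * A))
        - 2 * (tr ((p : H →L[ℂ] H) * A) * tr ((p : H →L[ℂ] H) * B)) := by
    have h3 : (-I) • comm (I • comm B p) (p : H →L[ℂ] H)
        = B * p - (2 : ℂ) • ((p : H →L[ℂ] H) * B * p) + p * B := by
      rw [comm_smul_left, smul_smul]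
      have : -I * I = 1 := by rw [neg_mul, I_mul_I, neg_neg]
      rw [this, one_smul, comm, comm, sub_mul, mul_sub, mul_assoc B, hp,
        ← mul_assoc (p : H →L[ℂ] H) p B, hp, two_smul, ← mul_assoc]
      abel
    rw [h3, add_mul, sub_mul, smul_mul_assoc, tr_add, tr_sub, tr_smul, tr_sandwich_mul,
      tr_cycle B, mul_assoc, mul_assoc]
    ring
  rw [h1, differential_re_obs, h2]
  refine conj_eq_iff_re.mp ?_
  have hA' : star A = A := hA
  have hB' : star B = B := hB
  simp only [map_mul, map_sub, map_add, conj_ofReal, p.conj_tr_mul hA hB, p.conj_tr_mul hB hA,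
    p.conj_tr, hA', hB', Complex.conj_ofNat]
  ring

theorem obs_im_eq_zero (κ : ℝ) {A : H →L[ℂ] H} (hA : IsSelfAdjoint A) (p : PH H) :
    (obs κ A p).im = 0 := by
  have hA' : star A = A := hA
  have h1 : (starRingEnd ℂ) (tr A) = tr A := by
    rw [tr_eq_sum (stdOrthonormalBasis ℂ H), map_sum]
    refine Finset.sum_congr rfl fun i _ => ?_
    rw [inner_conj_symm]
    exact hA.isSymmetric _ _
  refine conj_eq_iff_im.mp ?_
  simp only [obs, map_add, map_mul, map_div₀, map_sub, map_one, map_natCast, conj_ofReal, p.conj_tr,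
    hA', h1]

theorem obs_add_I_smul (κ : ℝ) (A B : H →L[ℂ] H) (p : PH H) :
    obs κ (A + I • B) p = obs κ A p + I * obs κ B p := by
  simp only [obs, mul_add, tr_add, mul_smul_comm, tr_smul]
  ring

theorem re_obs_add_I_smul (κ : ℝ) (A : H →L[ℂ] H) {B : H →L[ℂ] H} (hB : IsSelfAdjoint B)
    (p : PH H) : (obs κ (A + I • B) p).re = (obs κ A p).re := by
  rw [obs_add_I_smul, add_re, I_mul_re, obs_im_eq_zero κ hB]
  simp

theorem im_obs_add_I_smul (κ : ℝ) {A : H →L[ℂ] H} (B : H →L[ℂ] H) (hA : IsSelfAdjoint A)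
    (p : PH H) : (obs κ (A + I • B) p).im = (obs κ B p).re := by
  rw [obs_add_I_smul, add_im, I_mul_im, obs_im_eq_zero κ hA]
  simp

theorem exists_re_im (A : H →L[ℂ] H) : ∃ C, IsSelfAdjoint C ∧ ∃ D, IsSelfAdjoint D ∧
    A = C + I • D :=
  ⟨_, (realPart A).2, _, (imaginaryPart A).2, (realPart_add_I_smul_imaginaryPart A).symm⟩

theorem poisson_obs {κ : ℝ} (hκ : 0 < κ) (A B : H →L[ℂ] H) (p : PH H) :
    poisson hκ (obs κ A) (obs κ B) p
      = -(I * κ) * (tr ((p : H →L[ℂ] H) * (A * B)) - tr ((p : H →L[ℂ] H) * (B * A))) := by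
  obtain ⟨A, hA, A', hA', rfl⟩ := exists_re_im A
  obtain ⟨B, hB, B', hB', rfl⟩ := exists_re_im B
  simp only [poisson, complexify, re_obs_add_I_smul κ _ hA', re_obs_add_I_smul κ _ hB',
    im_obs_add_I_smul κ _ hA, im_obs_add_I_smul κ _ hB, ofReal_add, ofReal_sub,
    poissonReal_obs hκ hA hB, poissonReal_obs hκ hA' hB', poissonReal_obs hκ hA hB',
    poissonReal_obs hκ hA' hB]
  simp only [add_mul, mul_add, smul_mul_assoc, mul_smul_comm, tr_add, tr_smul]
  linear_combination (I * κ) * (tr ((p : H →L[ℂ] H) * (A' * B'))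
    - tr ((p : H →L[ℂ] H) * (B' * A'))) * I_mul_I

theorem gradProd_obs {κ : ℝ} (hκ : 0 < κ) (A B : H →L[ℂ] H) (p : PH H) :
    gradProd hκ (obs κ A) (obs κ B) p
      = κ * (tr ((p : H →L[ℂ] H) * (A * B)) + tr ((p : H →L[ℂ] H) * (B * A))
        - 2 * (tr ((p : H →L[ℂ] H) * A) * tr ((p : H →L[ℂ] H) * B))) := by
  obtain ⟨A, hA, A', hA', rfl⟩ := exists_re_im A
  obtain ⟨B, hB, B', hB', rfl⟩ := exists_re_im B
  simp only [gradProd, complexify, re_obs_add_I_smul κ _ hA', re_obs_add_I_smul κ _ hB',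
    im_obs_add_I_smul κ _ hA, im_obs_add_I_smul κ _ hB, ofReal_add, ofReal_sub,
    coMetric_obs hκ hA hB, coMetric_obs hκ hA' hB', coMetric_obs hκ hA hB',
    coMetric_obs hκ hA' hB]
  simp only [add_mul, mul_add, smul_mul_assoc, mul_smul_comm, tr_add, tr_smul]
  linear_combination (-κ) * (tr ((p : H →L[ℂ] H) * (A' * B'))
    + tr ((p : H →L[ℂ] H) * (B' * A'))
    - 2 * (tr ((p : H →L[ℂ] H) * A') * tr ((p : H →L[ℂ] H) * B'))) * I_mul_I

theorem starProd_obs {κ : ℝ} (hκ : κ ≠ 0) (hH : Module.finrank ℂ H ≠ 0) (A B : H →L[ℂ] H) :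
    starProd κ (obs κ A) (obs κ B) = obs κ (A * B) := by
  have h := Function.leftInverse_invFun (obs_injective (H := H) hκ hH)
  rw [starProd, h A, h B]

theorem integral_obs [Nontrivial H] (κ : ℝ) (A : H →L[ℂ] H) :
    ∫ p, obs κ A p ∂(projMeasure H) = tr A / Module.finrank ℂ H := by
  have hA := continuous_tr_mul A
  simp only [obs]
  rw [integral_add (integrable_of_continuous_PH (by fun_prop)) (integrable_const _), integral_const_mul, integral_tr, integral_const, probReal_univ, one_smul]
  ring

theorem integral_obs_mul_obs [Nontrivial H] (κ : ℝ) (A B : H →L[ℂ] H) :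
    ∫ p, obs κ A p * obs κ B p ∂(projMeasure H)
      = κ ^ 2 * ((tr A * tr B + tr (A * B))
          / (Module.finrank ℂ H * (Module.finrank ℂ H + 1)))
        + (1 - κ ^ 2) * (tr A * tr B) / Module.finrank ℂ H ^ 2 := by
  have hn : (Module.finrank ℂ H : ℂ) ≠ 0 := by
    exact_mod_cast (Module.finrank_pos (R := ℂ) (M := H)).ne'
  set c : ℂ := (1 - κ) / Module.finrank ℂ H with hc
  have hA := continuous_tr_mul A
  have hB := continuous_tr_mul B
  have h1 : ∀ p : PH H, obs κ A p * obs κ B p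
      = κ ^ 2 * (tr ((p : H →L[ℂ] H) * A) * tr ((p : H →L[ℂ] H) * B))
        + (κ * c * tr B) * tr ((p : H →L[ℂ] H) * A) + (κ * c * tr A) * tr ((p : H →L[ℂ] H) * B)
        + c ^ 2 * tr A * tr B := by
    intro p
    simp only [obs, ← hc]
    ring
  simp_rw [h1]
  rw [integral_add (integrable_of_continuous_PH (by fun_prop)) (integrable_const _),
    integral_add (integrable_of_continuous_PH (by fun_prop))
      (integrable_of_continuous_PH (by fun_prop)),
    integral_add (integrable_of_continuous_PH (by fun_prop))
      (integrable_of_continuous_PH (by fun_prop)),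
    integral_const_mul, integral_const_mul, integral_const_mul, integral_tr, integral_tr,
    integral_const, probReal_univ, one_smul]
  have h2 := secondMoment_eq A B
  rw [secondMoment] at h2
  rw [h2, hc]
  field_simp
  ring

/-- The product formula, for the observables of two operators. -/
theorem starProd_formula [Nontrivial H] {κ : ℝ} (hκ : 0 < κ) (A B : H →L[ℂ] H) (p : PH H) :
    starProd κ (obs κ A) (obs κ B) p =
      I / 2 * poisson hκ (obs κ A) (obs κ B) p + 1 / 2 * gradProd hκ (obs κ A) (obs κ B) p
      + obs κ A p * obs κ B p / κ
      + (1 - κ) / κ * ((Module.finrank ℂ H + 1) / κ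
          * (∫ q, obs κ A q * obs κ B q ∂(projMeasure H))
        - obs κ A p * (∫ q, obs κ B q ∂(projMeasure H))
        - obs κ B p * (∫ q, obs κ A q ∂(projMeasure H)))
      + (1 - κ) / κ ^ 2 * (κ - (Module.finrank ℂ H + 1)) * (∫ q, obs κ A q ∂(projMeasure H))
        * (∫ q, obs κ B q ∂(projMeasure H)) := by
  have hn0 : Module.finrank ℂ H ≠ 0 := (Module.finrank_pos (R := ℂ) (M := H)).ne'
  have hn : (Module.finrank ℂ H : ℂ) ≠ 0 := by exact_mod_cast hn0
  have hn1 : (Module.finrank ℂ H : ℂ) + 1 ≠ 0 := by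
    exact_mod_cast Nat.succ_ne_zero (Module.finrank ℂ H)
  have hκ' : (κ : ℂ) ≠ 0 := by exact_mod_cast hκ.ne'
  rw [starProd_obs hκ.ne' hn0, poisson_obs, gradProd_obs, integral_obs, integral_obs,
    integral_obs_mul_obs]
  simp only [obs]
  have hI : I / 2 * (-(I * κ) * (tr ((p : H →L[ℂ] H) * (A * B))
      - tr ((p : H →L[ℂ] H) * (B * A))))
      = κ / 2 * (tr ((p : H →L[ℂ] H) * (A * B)) - tr ((p : H →L[ℂ] H) * (B * A))) := by
    linear_combination (-κ / 2 * (tr ((p : H →L[ℂ] H) * (A * B))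
      - tr ((p : H →L[ℂ] H) * (B * A)))) * I_mul_I
  rw [hI]
  field_simp
  ring

end Brackets

/-! ### Cauchy's functional equation on an interval -/

section Cauchy

/-- The extension to `ℝ` of a function that is additive on `[0, 1]`. -/
def additiveExtension (a : ℝ → ℂ)
    (hadd : ∀ s t, 0 ≤ s → 0 ≤ t → s + t ≤ 1 → a (s + t) = a s + a t) : ℝ →+ ℂ :=
  AddMonoidHom.mk' (fun x => a (Int.fract x) + ⌊x⌋ * a 1) <| by
    intro x y
    have hx0 := Int.fract_nonneg x
    have hy0 := Int.fract_nonneg y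
    have hx1 := Int.fract_lt_one x
    have hy1 := Int.fract_lt_one y
    have hx := Int.floor_add_fract x
    have hy := Int.floor_add_fract y
    rcases lt_or_ge (Int.fract x + Int.fract y) 1 with h | h
    · have h1 : ⌊x + y⌋ = ⌊x⌋ + ⌊y⌋ := by
        rw [Int.floor_eq_iff]
        push_cast
        constructor <;> linarith
      have h2 : Int.fract (x + y) = Int.fract x + Int.fract y := by
        rw [Int.fract, h1]
        push_cast
        linarith
      simp only [h1, h2, hadd _ _ hx0 hy0 h.le]
      push_cast
      ring
    · have h1 : ⌊x + y⌋ = ⌊x⌋ + ⌊y⌋ + 1 := by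
        rw [Int.floor_eq_iff]
        push_cast
        constructor <;> linarith
      have h2 : Int.fract (x + y) = Int.fract x + Int.fract y - 1 := by
        rw [Int.fract, h1]
        push_cast
        linarith
      have h3 := hadd (Int.fract x + Int.fract y - 1) (1 - Int.fract y) (by linarith) (by linarith)
        (by linarith)
      have h4 := hadd (Int.fract y) (1 - Int.fract y) hy0 (by linarith) (by linarith)
      have e3 : Int.fract x + Int.fract y - 1 + (1 - Int.fract y) = Int.fract x := by ring
      have e4 : Int.fract y + (1 - Int.fract y) = 1 := by ring
      rw [e3] at h3
      rw [e4] at h4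
      simp only [h1, h2]
      push_cast
      linear_combination -h3 + h4

/-- Cauchy's functional equation on `[0, 1]`: a solution that agrees almost everywhere with a
measurable function is linear. By Steinhaus' theorem it is bounded near zero. -/
theorem eq_mul_of_additive {a a₀ : ℝ → ℂ}
    (hadd : ∀ s t, 0 ≤ s → 0 ≤ t → s + t ≤ 1 → a (s + t) = a s + a t) (h₀ : Measurable a₀)
    (hae : ∀ᵐ t : ℝ, t ∈ Ioo (0 : ℝ) 1 → a t = a₀ t) {t : ℝ} (ht : t ∈ Icc (0 : ℝ) 1) :
    a t = t * a 1 := by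
  set N : Set ℝ := toMeasurable volume {t | ¬ (t ∈ Ioo (0 : ℝ) 1 → a t = a₀ t)} with hN
  have hN0 : volume N = 0 := by rw [hN, measure_toMeasurable]; exact ae_iff.mp hae
  have hNa : ∀ t ∈ Ioo (0 : ℝ) 1, t ∉ N → a t = a₀ t := by
    intro t ht htN
    by_contra h
    exact htN (subset_toMeasurable _ _ fun h' => h (h' ht))
  let S : ℕ → Set ℝ := fun k => (Ioo (0 : ℝ) 1 \ N) ∩ {t | ‖a₀ t‖ ≤ k}
  have hSm : ∀ k, MeasurableSet (S k) := fun k =>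
    (measurableSet_Ioo.diff (measurableSet_toMeasurable _ _)).inter
      (measurableSet_le h₀.norm measurable_const)
  obtain ⟨k, hk⟩ : ∃ k, 0 < volume (S k) := by
    by_contra hcon
    have h1 : ∀ k, volume (S k) = 0 := fun k => by
      by_contra h
      exact hcon ⟨k, pos_iff_ne_zero.mpr h⟩
    have h2 : Ioo (0 : ℝ) 1 ⊆ N ∪ ⋃ k, S k := by
      intro t ht
      by_cases htN : t ∈ N
      · exact Or.inl htN
      · obtain ⟨k, hk⟩ := exists_nat_ge ‖a₀ t‖
        exact Or.inr (mem_iUnion.mpr ⟨k, ⟨ht, htN⟩, hk⟩)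
    have h3 : volume (Ioo (0 : ℝ) 1) = 0 :=
      measure_mono_null h2 (measure_union_null hN0 (measure_iUnion_null h1))
    simp at h3
  have hnhds := Measure.sub_mem_nhds_zero_of_addHaar_pos volume (S k) (hSm k) hk
  let A := additiveExtension a hadd
  have hA : ∀ s ∈ Ico (0 : ℝ) 1, A s = a s := by
    intro s hs
    change a (Int.fract s) + ⌊s⌋ * a 1 = a s
    rw [Int.fract_eq_self.mpr hs, Int.floor_eq_zero_iff.mpr hs]
    simp
  have hbd : ∀ s ∈ S k, ‖A s‖ ≤ k := by
    intro s hs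
    rw [hA s ⟨hs.1.1.1.le, hs.1.1.2⟩, hNa s hs.1.1 hs.1.2]
    exact hs.2
  have hcont : Continuous A := by
    refine A.continuous_of_isBounded_nhds_zero hnhds ?_
    rw [isBounded_iff_forall_norm_le]
    refine ⟨k + k, ?_⟩
    rintro _ ⟨_, ⟨x, hx, y, hy, rfl⟩, rfl⟩
    simp only [map_sub]
    exact (norm_sub_le _ _).trans (add_le_add (hbd x hx) (hbd y hy))
  have h0 : a 0 = 0 := by
    have := hadd 0 0 le_rfl le_rfl (by norm_num)
    rw [add_zero] at this
    linear_combination -this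
  have hA1 : A 1 = a 1 := by
    change a (Int.fract 1) + ⌊(1 : ℝ)⌋ * a 1 = a 1
    simp [h0]
  rcases eq_or_lt_of_le ht.2 with rfl | ht1
  · simp
  · have h1 := map_real_smul A hcont t 1
    rw [smul_eq_mul, mul_one, hA t ⟨ht.1, ht1⟩, hA1] at h1
    rw [h1, Complex.real_smul]

end Cauchy

/-! ### Almost every point of an arc -/

section Slices

variable {H : Type*} [NormedAddCommGroup H] [InnerProductSpace ℂ H] [FiniteDimensional ℂ H]

/-- The operator multiplying the component along `e` by `σ`. -/
def dilation (e : H) (σ : ℝ) : H →ₗ[ℝ] H :=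
  LinearMap.id + ((σ : ℂ) - 1) • ((innerSL ℂ e).smulRight e).toLinearMap.restrictScalars ℝ

theorem dilation_apply (e : H) (σ : ℝ) (v : H) :
    dilation e σ v = v + (((σ : ℂ) - 1) * ⟪e, v⟫_ℂ) • e := by
  simp [dilation, smul_smul]

theorem det_dilation_ne_zero {e : H} (he : ‖e‖ = 1) {σ : ℝ} (hσ : σ ≠ 0) :
    LinearMap.det (dilation e σ) ≠ 0 := by
  have h : dilation e σ ∘ₗ dilation e σ⁻¹ = LinearMap.id := by
    ext v
    have hσ' : (σ : ℂ) ≠ 0 := by exact_mod_cast hσ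
    have hee : ⟪e, e⟫_ℂ = 1 := by rw [inner_self_eq_norm_sq_to_K, he]; simp
    simp only [LinearMap.comp_apply, dilation_apply, inner_add_right, inner_smul_right, hee,
      LinearMap.id_apply, add_assoc, ← add_smul]
    have : ((σ⁻¹ : ℝ) - 1 : ℂ) * ⟪e, v⟫_ℂ
        + (σ - 1) * (⟪e, v⟫_ℂ + ((σ⁻¹ : ℝ) - 1 : ℂ) * ⟪e, v⟫_ℂ * 1) = 0 := by
      push_cast
      field_simp
      ring
    rw [this, zero_smul, add_zero]
  intro h0
  have h1 := congrArg LinearMap.det h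
  rw [LinearMap.det_comp, h0, zero_mul, LinearMap.det_id] at h1
  exact zero_ne_one h1

variable [MeasurableSpace H] [BorelSpace H]

/-- The cone over a null set of the unit sphere is a null set. -/
theorem exists_null_cone [Nontrivial H] {M : Set (sphere (0 : H) 1)} (hM : sphereProb H M = 0) :
    ∃ C : Set H, MeasurableSet C ∧ (Measure.addHaar : Measure H) C = 0 ∧
      ∀ (x : sphere (0 : H) 1) (r : ℝ), 0 < r → r • (x : H) ∉ C → x ∉ M := by
  have : ProperSpace H := FiniteDimensional.proper_rclike ℂ H
  have : FiniteDimensional ℝ H := FiniteDimensional.complexToReal H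
  set μ : Measure H := Measure.addHaar
  have hM' : μ.toSphere M = 0 := by
    rw [sphereProb, Measure.smul_apply, smul_eq_mul, mul_eq_zero] at hM
    exact hM.resolve_left (ENNReal.inv_ne_zero.mpr (measure_ne_top _ _))
  set T := toMeasurable μ.toSphere M
  have hT : MeasurableSet T := measurableSet_toMeasurable _ _
  have hT0 : μ.toSphere T = 0 := by rw [measure_toMeasurable, hM']
  have hmp := μ.measurePreserving_homeomorphUnitSphereProd
  refine ⟨Subtype.val '' (homeomorphUnitSphereProd H ⁻¹' (T ×ˢ univ)), ?_, ?_, ?_⟩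
  · exact MeasurableSet.subtype_image (measurableSet_singleton _).compl
      (hmp.measurable (hT.prod MeasurableSet.univ))
  · rw [← comap_subtype_coe_apply (measurableSet_singleton _).compl,
      hmp.measure_preimage (hT.prod MeasurableSet.univ).nullMeasurableSet, Measure.prod_prod, hT0,
      zero_mul]
  · intro x r hr hx hxM
    refine hx ⟨(homeomorphUnitSphereProd H).symm (x, ⟨r, hr⟩), ?_, ?_⟩
    · simp only [mem_preimage, Homeomorph.apply_symm_apply]
      exact ⟨subset_toMeasurable _ _ hxM, trivial⟩
    · simp

/-- A property holding almost everywhere on the sphere holds almost everywhere along some arc of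
a great circle issuing from `e`, parametrised by `t = |⟨e, x⟩|²`. -/
theorem exists_slice (hdim : 2 ≤ Module.finrank ℂ H) {e : H} (he : ‖e‖ = 1)
    {P : sphere (0 : H) 1 → Prop} (hP : ∀ᵐ x ∂(sphereProb H), P x) :
    ∃ q : ℝ → sphere (0 : H) 1, Continuous q ∧
      (∀ t ∈ Icc (0 : ℝ) 1, ‖⟪e, (q t : H)⟫_ℂ‖ ^ 2 = t) ∧
      ∀ᵐ t : ℝ, t ∈ Ioo (0 : ℝ) 1 → P (q t) := by
  have : Nontrivial H := Module.nontrivial_of_finrank_pos (R := ℂ) (by omega)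
  have : ProperSpace H := FiniteDimensional.proper_rclike ℂ H
  have : FiniteDimensional ℝ H := FiniteDimensional.complexToReal H
  obtain ⟨C, hCm, hC0, hC⟩ := exists_null_cone (ae_iff.mp hP)
  have hee : ⟪e, e⟫_ℂ = 1 := by rw [inner_self_eq_norm_sq_to_K, he]; simp
  -- for almost every `v`, the dilated vectors avoid the null cone for almost all factors
  have h1 : ∀ᵐ σ : ℝ, ∀ᵐ v ∂(Measure.addHaar : Measure H), σ ≠ 0 → dilation e σ v ∉ C := by
    refine Filter.Eventually.of_forall fun σ => ?_
    by_cases hσ : σ = 0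
    · exact Filter.Eventually.of_forall fun v h => (h hσ).elim
    · have := Measure.addHaar_preimage_linearMap (Measure.addHaar : Measure H)
        (det_dilation_ne_zero he hσ) C
      rw [hC0, mul_zero] at this
      filter_upwards [measure_eq_zero_iff_ae_notMem.mp this] with v hv _
      exact hv
  have hmeas : MeasurableSet {x : ℝ × H | x.1 ≠ 0 → dilation e x.1 x.2 ∉ C} := by
    have hc : Continuous fun x : ℝ × H => dilation e x.1 x.2 := by
      simp only [dilation_apply]
      fun_prop
    have hs : MeasurableSet {x : ℝ × H | x.1 = 0} := measurable_fst (measurableSet_singleton 0)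
    convert hs.union (hc.measurable hCm.compl) using 1
    ext x
    simp only [mem_ofPred_eq, mem_union, mem_preimage, mem_compl_iff]
    tauto
  rw [Measure.ae_ae_comm hmeas] at h1
  -- choose such a `v` that is neither a multiple of `e` nor orthogonal to it
  obtain ⟨v, hv, hv1, hv2⟩ : ∃ v : H, (∀ᵐ σ : ℝ, σ ≠ 0 → dilation e σ v ∉ C) ∧ ⟪e, v⟫_ℂ ≠ 0 ∧
      v - ⟪e, v⟫_ℂ • e ≠ 0 := by
    have hopen : IsOpen {v : H | ⟪e, v⟫_ℂ ≠ 0 ∧ v - ⟪e, v⟫_ℂ • e ≠ 0} := by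
      refine IsOpen.inter ?_ ?_
      · exact isOpen_ne_fun (by fun_prop) continuous_const
      · exact isOpen_ne_fun (by fun_prop) continuous_const
    have hne : {v : H | ⟪e, v⟫_ℂ ≠ 0 ∧ v - ⟪e, v⟫_ℂ • e ≠ 0}.Nonempty := by
      obtain ⟨w, hw⟩ : ∃ w : H, w ∉ Submodule.span ℂ {e} := by
        by_contra hcon
        have htop : Submodule.span ℂ {e} = ⊤ := by
          rw [Submodule.eq_top_iff']
          intro w
          by_contra hw
          exact hcon ⟨w, hw⟩
        have h3 := finrank_span_singleton (K := ℂ) (v := e) (by rintro rfl; simp at he)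
        rw [htop, finrank_top] at h3
        omega
      refine ⟨e + (w - ⟪e, w⟫_ℂ • e), ?_, ?_⟩
      · rw [inner_add_right, inner_sub_right, inner_smul_right, hee, mul_one, sub_self, add_zero]
        exact one_ne_zero
      · simp only [inner_add_right, inner_sub_right, inner_smul_right, hee, mul_one, sub_self,
          add_zero, one_smul, add_sub_cancel_left]
        intro h0
        exact hw (Submodule.mem_span_singleton.mpr ⟨_, (sub_eq_zero.mp h0).symm⟩)
    obtain ⟨v, hv, hv'⟩ := (Measure.dense_of_ae h1).inter_open_nonempty _ hopen hne
    exact ⟨v, hv', hv⟩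
  set z := ⟪e, v⟫_ℂ with hz
  set w := v - z • e with hw
  have hzpos : 0 < ‖z‖ := norm_pos_iff.mpr hv1
  have hwpos : 0 < ‖w‖ := norm_pos_iff.mpr hv2
  have hew : ⟪e, w⟫_ℂ = 0 := by rw [hw, inner_sub_right, inner_smul_right, hee, ← hz]; ring
  have hzc : (‖z‖ : ℂ) ≠ 0 := by exact_mod_cast hzpos.ne'
  have hwc : (‖w‖ : ℂ) ≠ 0 := by exact_mod_cast hwpos.ne'
  let y : ℝ → H := fun t => ((Real.sqrt t : ℂ) * (z / ‖z‖)) • e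
    + ((Real.sqrt (1 - t) : ℂ) * (‖w‖ : ℂ)⁻¹) • w
  have hynorm : ∀ t ∈ Icc (0 : ℝ) 1, ‖y t‖ = 1 := by
    intro t ht
    have h3 := norm_add_sq_eq_norm_sq_add_norm_sq_of_inner_eq_zero
      (((Real.sqrt t : ℂ) * (z / ‖z‖)) • e) (((Real.sqrt (1 - t) : ℂ) * (‖w‖ : ℂ)⁻¹) • w)
      (by rw [inner_smul_left, inner_smul_right, hew]; simp)
    have h4 : ‖((Real.sqrt t : ℂ) * (z / ‖z‖)) • e‖ = Real.sqrt t := by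
      rw [norm_smul, he, norm_mul, norm_div, norm_real, norm_real, norm_norm, div_self hzpos.ne',
        Real.norm_of_nonneg (Real.sqrt_nonneg _)]
      ring
    have h5 : ‖((Real.sqrt (1 - t) : ℂ) * (‖w‖ : ℂ)⁻¹) • w‖ = Real.sqrt (1 - t) := by
      rw [norm_smul, norm_mul, norm_inv, norm_real, norm_real, norm_norm,
        Real.norm_of_nonneg (Real.sqrt_nonneg _), mul_assoc, inv_mul_cancel₀ hwpos.ne', mul_one]
    rw [h4, h5, Real.mul_self_sqrt ht.1, Real.mul_self_sqrt (by linarith [ht.2])] at h3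
    have h6 : ‖y t‖ * ‖y t‖ = 1 := h3.trans (by ring)
    nlinarith [norm_nonneg (y t)]
  have hyin : ∀ t ∈ Icc (0 : ℝ) 1, ‖⟪e, y t⟫_ℂ‖ ^ 2 = t := by
    intro t ht
    have : ⟪e, y t⟫_ℂ = (Real.sqrt t : ℂ) * (z / ‖z‖) := by
      simp only [y, inner_add_right, inner_smul_right, hee, hew]
      ring
    rw [this, norm_mul, norm_div, norm_real, norm_real, norm_norm, div_self hzpos.ne', mul_one,
      Real.norm_of_nonneg (Real.sqrt_nonneg _), Real.sq_sqrt ht.1]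
  have hyc : Continuous y := by
    have : Continuous fun t : ℝ => ((Real.sqrt t : ℝ) : ℂ) :=
      continuous_ofReal.comp Real.continuous_sqrt
    have : Continuous fun t : ℝ => ((Real.sqrt (1 - t) : ℝ) : ℂ) :=
      continuous_ofReal.comp (Real.continuous_sqrt.comp (by fun_prop))
    fun_prop
  refine ⟨fun t => ⟨y (projIcc 0 1 zero_le_one t), by
    simpa using hynorm _ (projIcc (0 : ℝ) 1 zero_le_one t).2⟩, ?_, ?_, ?_⟩
  · exact Continuous.subtype_mk (hyc.comp (continuous_subtype_val.comp continuous_projIcc)) _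
  · intro t ht
    simp only [projIcc_of_mem _ ht]
    exact hyin t ht
  · -- the bad parameters are the image of a null set of factors under a smooth map
    have hbad : volume {σ : ℝ | ¬ (σ ≠ 0 → dilation e σ v ∉ C)} = 0 := ae_iff.mp hv
    let τ : ℝ → ℝ := fun σ => σ ^ 2 * ‖z‖ ^ 2 / (σ ^ 2 * ‖z‖ ^ 2 + ‖w‖ ^ 2)
    have hτ : Differentiable ℝ τ := by
      intro σ
      have h4 : σ ^ 2 * ‖z‖ ^ 2 + ‖w‖ ^ 2 ≠ 0 := by positivity
      simp only [τ]
      fun_prop (disch := exact h4)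
    have himg := addHaar_image_eq_zero_of_differentiableOn_of_addHaar_eq_zero volume
      hτ.differentiableOn hbad
    refine ae_iff.mpr (measure_mono_null (fun t ht => ?_) himg)
    simp only [mem_ofPred_eq, Classical.not_imp] at ht
    obtain ⟨ht, htP⟩ := ht
    have ht0 : 0 < Real.sqrt t := Real.sqrt_pos.mpr ht.1
    have ht1 : 0 < Real.sqrt (1 - t) := Real.sqrt_pos.mpr (by linarith [ht.2])
    have hs0 : Real.sqrt t ^ 2 = t := Real.sq_sqrt ht.1.le
    have hs1 : Real.sqrt (1 - t) ^ 2 = 1 - t := Real.sq_sqrt (by linarith [ht.2])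
    have h1c : (Real.sqrt (1 - t) : ℂ) ≠ 0 := by exact_mod_cast ht1.ne'
    refine ⟨‖w‖ / ‖z‖ * (Real.sqrt t / Real.sqrt (1 - t)), ?_, ?_⟩
    · simp only [mem_ofPred_eq, Classical.not_imp, not_not]
      refine ⟨by positivity, ?_⟩
      by_contra hnot
      refine hC _ (‖w‖ / Real.sqrt (1 - t)) (by positivity) ?_ htP
      convert hnot using 1
      have hv3 : v = z • e + w := by rw [hw, add_sub_cancel]
      rw [dilation_apply, ← hz]
      conv_rhs => rw [hv3]
      rw [projIcc_of_mem _ ⟨ht.1.le, ht.2.le⟩, ← Complex.coe_smul]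
      simp only [y, smul_add, smul_smul]
      push_cast
      have e1 : (‖w‖ : ℂ) / Real.sqrt (1 - t) * (Real.sqrt (1 - t) * (‖w‖ : ℂ)⁻¹) = 1 := by
        field_simp
      have e2 : (‖w‖ : ℂ) / Real.sqrt (1 - t) * (Real.sqrt t * (z / ‖z‖))
          = z + (‖w‖ / ‖z‖ * (Real.sqrt t / Real.sqrt (1 - t)) - 1) * z := by
        field_simp
        ring
      rw [e1, e2, add_smul, one_smul]
      rw [add_right_comm (z • e)]
    · have hz2 : ‖z‖ ≠ 0 := hzpos.ne'
      have hw2 : ‖w‖ ≠ 0 := hwpos.ne'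
      have e1 : (‖w‖ / ‖z‖ * (Real.sqrt t / Real.sqrt (1 - t))) ^ 2 * ‖z‖ ^ 2
          = ‖w‖ ^ 2 * (t / (1 - t)) := by
        rw [mul_pow, div_pow, div_pow, hs0, hs1]
        field_simp
      have h1t : 1 - t ≠ 0 := by linarith [ht.2]
      simp only [τ, e1]
      field_simp
      ring

end Slices

/-! ### The stabiliser of a vector -/

section Stabilizer

variable {H : Type*} [NormedAddCommGroup H] [InnerProductSpace ℂ H] [FiniteDimensional ℂ H]
  [CompleteSpace H]

/-- The group of the unitary operators that fix the vector `e`. -/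
def stab (e : H) : Subgroup (unitary (H →L[ℂ] H)) where
  carrier := {U | (U : H →L[ℂ] H) e = e}
  one_mem' := rfl
  mul_mem' := by
    intro U V hU hV
    change (U : H →L[ℂ] H) ((V : H →L[ℂ] H) e) = e
    rw [show (V : H →L[ℂ] H) e = e from hV, show (U : H →L[ℂ] H) e = e from hU]
  inv_mem' := by
    intro U hU
    have h : ((U⁻¹ * U : unitary (H →L[ℂ] H)) : H →L[ℂ] H) e = e := by
      rw [inv_mul_cancel]
      rfl
    change ((U⁻¹ : unitary (H →L[ℂ] H)) : H →L[ℂ] H) ((U : H →L[ℂ] H) e) = e at h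
    rwa [show (U : H →L[ℂ] H) e = e from hU] at h

instance compactSpace_unitary : CompactSpace (unitary (H →L[ℂ] H)) := by
  have : ProperSpace (H →L[ℂ] H) := FiniteDimensional.proper_rclike ℂ _
  refine isCompact_iff_compactSpace (s := (unitary (H →L[ℂ] H) : Set (H →L[ℂ] H))).mp ?_
  refine Metric.isCompact_of_isClosed_isBounded isClosed_unitary ?_
  rw [isBounded_iff_forall_norm_le]
  refine ⟨1, fun U hU => ?_⟩
  refine U.opNorm_le_bound zero_le_one fun x => ?_
  rw [one_mul]
  exact ((Unitary.linearIsometryEquiv ⟨U, hU⟩).norm_map x).le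

instance compactSpace_stab (e : H) : CompactSpace (stab e) := by
  have hc : IsClosed {U : unitary (H →L[ℂ] H) | (U : H →L[ℂ] H) e = e} :=
    isClosed_eq (by fun_prop) continuous_const
  exact isCompact_iff_compactSpace.mp hc.isCompact

instance measurableSpace_stab (e : H) : MeasurableSpace (stab e) := borel _

instance borelSpace_stab (e : H) : BorelSpace (stab e) := ⟨rfl⟩

/-- The normalised Haar measure of the stabiliser of `e`. -/
def stabHaar (e : H) : Measure (stab e) := Measure.haarMeasure ⊤

instance (e : H) : IsProbabilityMeasure (stabHaar e) := ⟨Measure.haarMeasure_self⟩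

instance (e : H) : (stabHaar e).IsMulLeftInvariant :=
  inferInstanceAs (Measure.haarMeasure _).IsMulLeftInvariant

/-- The action of the inverse of `k`. With the inverse, translating the argument by an element of
the stabiliser amounts to a left translation of `k`. -/
def rot {e : H} (k : stab e) : H ≃ₗᵢ[ℂ] H :=
  Unitary.linearIsometryEquiv ((k⁻¹ : stab e) : unitary (H →L[ℂ] H))

theorem rot_apply {e : H} (k : stab e) (x : H) :
    rot k x = (((k⁻¹ : stab e) : unitary (H →L[ℂ] H)) : H →L[ℂ] H) x := rfl

theorem rot_self {e : H} (k : stab e) : rot k e = e := (k⁻¹).2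

theorem inner_rot {e : H} (k : stab e) (x : H) : ⟪e, rot k x⟫_ℂ = ⟪e, x⟫_ℂ := by
  have h := (rot k).inner_map_map e x
  rwa [rot_self] at h

theorem exists_rot_comp {e : H} (V : H ≃ₗᵢ[ℂ] H) (hV : V e = e) :
    ∃ g : stab e, ∀ (k : stab e) (x : H), rot k (V x) = rot (g * k) x := by
  have hg : Unitary.linearIsometryEquiv.symm V ∈ stab e := hV
  refine ⟨(⟨_, hg⟩ : stab e)⁻¹, fun k x => ?_⟩
  rw [rot_apply, rot_apply, mul_inv_rev, inv_inv]
  rfl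

/-- The action of the stabiliser on the sphere. -/
def rotSphere {e : H} (z : stab e × sphere (0 : H) 1) : sphere (0 : H) 1 :=
  sphereAct (rot z.1) z.2

theorem continuous_rotSphere {e : H} : Continuous (rotSphere (e := e)) := by
  refine Continuous.subtype_mk ?_ _
  have h1 : Continuous fun z : stab e × sphere (0 : H) 1 =>
      (((z.1⁻¹ : stab e) : unitary (H →L[ℂ] H)) : H →L[ℂ] H) :=
    continuous_subtype_val.comp (continuous_subtype_val.comp (continuous_inv.comp continuous_fst))
  have h2 : Continuous fun z : stab e × sphere (0 : H) 1 => (z.2 : H) :=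
    continuous_subtype_val.comp continuous_snd
  exact h1.clm_apply h2

variable [MeasurableSpace H] [BorelSpace H]

theorem measurePreserving_rotSphere [Nontrivial H] (e : H) :
    MeasurePreserving (rotSphere (e := e)) ((stabHaar e).prod (sphereProb H)) (sphereProb H) := by
  have : ProperSpace H := FiniteDimensional.proper_rclike ℂ H
  have : ProperSpace (H →L[ℂ] H) := FiniteDimensional.proper_rclike ℂ _
  have hm : Measurable (Function.uncurry fun (k : stab e) (x : sphere (0 : H) 1) =>
      sphereAct (rot k) x) := continuous_rotSphere.measurable
  have h := (MeasurePreserving.id (stabHaar e)).skew_product hm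
    (Filter.Eventually.of_forall fun k => (measurePreserving_sphereAct (rot k)).map_eq)
  exact (measurePreserving_snd (μ := stabHaar e) (ν := sphereProb H)).comp h

end Stabilizer

/-! ### Averages over the orbits of the stabiliser -/

section Average

variable {H : Type*} [NormedAddCommGroup H] [InnerProductSpace ℂ H] [FiniteDimensional ℂ H]
  [CompleteSpace H]

/-- Integrability of `f` over the orbit of `x` under the stabiliser of `e`. -/
def OrbitIntegrable (e : H) (f : sphere (0 : H) 1 → ℂ) (x : sphere (0 : H) 1) : Prop :=
  Integrable (fun k : stab e => f (rotSphere (k, x))) (stabHaar e)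

/-- The mean of `f` over the orbit of `x` under the stabiliser of `e`. -/
def orbitAverage (e : H) (f : sphere (0 : H) 1 → ℂ) (x : sphere (0 : H) 1) : ℂ :=
  ∫ k : stab e, f (rotSphere (k, x)) ∂(stabHaar e)

theorem orbit_map {e : H} (f : sphere (0 : H) 1 → ℂ) (V : H ≃ₗᵢ[ℂ] H) (hV : V e = e)
    (x : sphere (0 : H) 1) :
    (OrbitIntegrable e f x → OrbitIntegrable e f (sphereAct V x)) ∧
      orbitAverage e f (sphereAct V x) = orbitAverage e f x := by
  obtain ⟨g, hg⟩ := exists_rot_comp V hV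
  have h : ∀ k : stab e, rotSphere (k, sphereAct V x) = rotSphere (g * k, x) := fun k =>
    Subtype.ext (hg k x)
  refine ⟨fun hx => ?_, ?_⟩
  · unfold OrbitIntegrable
    simp_rw [h]
    exact Integrable.comp_mul_left hx g
  · unfold orbitAverage
    simp_rw [h]
    exact integral_mul_left_eq_self (fun k => f (rotSphere (k, x))) g

/-- Unit vectors with the same component along `e` are related by a unitary operator fixing
`e`. -/
theorem exists_unitary_of_inner_eq {e : H} (he : ‖e‖ = 1) {x x' : sphere (0 : H) 1}
    (h : ⟪e, (x : H)⟫_ℂ = ⟪e, (x' : H)⟫_ℂ) : ∃ V : H ≃ₗᵢ[ℂ] H, V e = e ∧ V x = x' := by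
  have hee : ⟪e, e⟫_ℂ = 1 := by rw [inner_self_eq_norm_sq_to_K, he]; simp
  set z := ⟪e, (x : H)⟫_ℂ with hz
  have hperp : ∀ y : sphere (0 : H) 1, ⟪e, (y : H)⟫_ℂ = z → ⟪e, (y : H) - z • e⟫_ℂ = 0 := by
    intro y hy
    rw [inner_sub_right, inner_smul_right, hee, hy]
    ring
  have hnorm : ∀ y : sphere (0 : H) 1, ⟪e, (y : H)⟫_ℂ = z →
      ‖(y : H) - z • e‖ ^ 2 = 1 - ‖z‖ ^ 2 := by
    intro y hy
    have h1 := norm_add_sq_eq_norm_sq_add_norm_sq_of_inner_eq_zero (z • e) ((y : H) - z • e)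
      (by rw [inner_smul_left, hperp y hy, mul_zero])
    rw [add_sub_cancel, norm_smul, he, norm_eq_of_mem_sphere] at h1
    linarith
  have hsame : ‖(x' : H) - z • e‖ = ‖(x : H) - z • e‖ := by
    rw [← pow_left_inj₀ (norm_nonneg _) (norm_nonneg _) two_ne_zero, hnorm x hz.symm,
      hnorm x' h.symm]
  by_cases hw : (x : H) - z • e = 0
  · have hw' : (x' : H) - z • e = 0 := by rw [← norm_eq_zero, hsame, hw, norm_zero]
    refine ⟨LinearIsometryEquiv.refl ℂ H, rfl, ?_⟩
    change (x : H) = x'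
    rw [sub_eq_zero.mp hw, sub_eq_zero.mp hw']
  set r := ‖(x : H) - z • e‖ with hr
  have hr0 : r ≠ 0 := norm_ne_zero_iff.mpr hw
  have hrc : (r : ℂ) ≠ 0 := by exact_mod_cast hr0
  have hon : ∀ y : sphere (0 : H) 1, ⟪e, (y : H)⟫_ℂ = z → ‖(y : H) - z • e‖ = r →
      Orthonormal ℂ ![e, (r : ℂ)⁻¹ • ((y : H) - z • e)] := by
    intro y hy hyr
    have h1 : ⟪e, (r : ℂ)⁻¹ • ((y : H) - z • e)⟫_ℂ = 0 := by
      rw [inner_smul_right, hperp y hy, mul_zero]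
    have h2 : ⟪(r : ℂ)⁻¹ • ((y : H) - z • e), e⟫_ℂ = 0 := by
      rw [← inner_conj_symm, h1, map_zero]
    refine ⟨fun i => ?_, fun i j hij => ?_⟩
    · fin_cases i
      · exact he
      · change ‖(r : ℂ)⁻¹ • ((y : H) - z • e)‖ = 1
        rw [norm_smul, hyr, norm_inv, norm_real, Real.norm_of_nonneg (hr ▸ norm_nonneg _),
          inv_mul_cancel₀ hr0]
    · fin_cases i <;> fin_cases j
      · exact (hij rfl).elim
      · exact h1
      · exact h2
      · exact (hij rfl).elim
  obtain ⟨V, hV⟩ := exists_unitary_of_orthonormal (hon x hz.symm hr.symm) (hon x' h.symm hsame)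
  have hVe : V e = e := hV 0
  have hVw : V ((r : ℂ)⁻¹ • ((x : H) - z • e)) = (r : ℂ)⁻¹ • ((x' : H) - z • e) := hV 1
  refine ⟨V, hVe, ?_⟩
  rw [map_smul, map_sub, map_smul, hVe] at hVw
  have := smul_right_injective H (inv_ne_zero hrc) hVw
  exact sub_left_injective this

theorem toProj_eq_of_smul {x x' : sphere (0 : H) 1} {c : ℂ} (hc : ‖c‖ = 1)
    (h : (x' : H) = c • (x : H)) : toProj x' = toProj x := by
  apply Subtype.ext
  ext y
  change ⟪(x' : H), y⟫_ℂ • (x' : H) = ⟪(x : H), y⟫_ℂ • (x : H)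
  rw [h, inner_smul_left, smul_smul, mul_right_comm, ← normSq_eq_conj_mul_self, normSq_eq_norm_sq,
    hc]
  simp

/-- For a function on the projective space, integrability and mean over the orbit of a unit vector
`x` under the stabiliser of `e` only depend on `|⟨e, x⟩|`. -/
theorem orbit_congr {e : H} (he : ‖e‖ = 1) (F : PH H → ℂ) {x x' : sphere (0 : H) 1}
    (h : ‖⟪e, (x : H)⟫_ℂ‖ = ‖⟪e, (x' : H)⟫_ℂ‖) :
    (OrbitIntegrable e (F ∘ toProj) x → OrbitIntegrable e (F ∘ toProj) x') ∧
      orbitAverage e (F ∘ toProj) x' = orbitAverage e (F ∘ toProj) x := by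
  obtain ⟨c, hc, hcx⟩ : ∃ c : ℂ, ‖c‖ = 1 ∧ ⟪e, (x' : H)⟫_ℂ = c * ⟪e, (x : H)⟫_ℂ := by
    by_cases h0 : ⟪e, (x : H)⟫_ℂ = 0
    · refine ⟨1, norm_one, ?_⟩
      rw [h0, norm_zero, eq_comm, norm_eq_zero] at h
      rw [h, h0, mul_zero]
    · refine ⟨⟪e, (x' : H)⟫_ℂ / ⟪e, (x : H)⟫_ℂ, ?_, (div_mul_cancel₀ _ h0).symm⟩
      rw [norm_div, h, div_self]
      rw [← h]
      exact norm_ne_zero_iff.mpr h0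
  let y : sphere (0 : H) 1 := ⟨c • (x : H), by simp [norm_smul, hc]⟩
  obtain ⟨V, hVe, hVy⟩ := exists_unitary_of_inner_eq he (x := y) (x' := x')
    (by rw [hcx]; exact inner_smul_right _ _ _)
  have hxy : ∀ k : stab e, (F ∘ toProj) (rotSphere (k, y)) = (F ∘ toProj) (rotSphere (k, x)) := by
    intro k
    refine congrArg F (toProj_eq_of_smul hc ?_)
    exact (rot k).map_smul c (x : H)
  have hx' : sphereAct V y = x' := Subtype.ext hVy
  have h1 := orbit_map (F ∘ toProj) V hVe y
  rw [hx'] at h1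
  have h2 : orbitAverage e (F ∘ toProj) y = orbitAverage e (F ∘ toProj) x := by
    unfold orbitAverage
    simp_rw [hxy]
  refine ⟨fun hx => h1.1 ?_, h1.2.trans h2⟩
  unfold OrbitIntegrable at hx ⊢
  simp_rw [hxy]
  exact hx

section Measurability

variable [MeasurableSpace H] [BorelSpace H]

theorem integrable_comp_rotSphere [Nontrivial H] (e : H) {f : sphere (0 : H) 1 → ℂ}
    (hf : Integrable f (sphereProb H)) :
    Integrable (f ∘ rotSphere (e := e)) ((stabHaar e).prod (sphereProb H)) :=
  (measurePreserving_rotSphere e).integrable_comp_of_integrable hf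

theorem ae_orbitIntegrable [Nontrivial H] (e : H) {f : sphere (0 : H) 1 → ℂ}
    (hf : Integrable f (sphereProb H)) : ∀ᵐ x ∂(sphereProb H), OrbitIntegrable e f x :=
  (integrable_comp_rotSphere e hf).prod_left_ae

theorem exists_measurable_orbitAverage [Nontrivial H] (e : H) {f : sphere (0 : H) 1 → ℂ}
    (hf : Integrable f (sphereProb H)) :
    ∃ g : sphere (0 : H) 1 → ℂ, Measurable g ∧ ∀ᵐ x ∂(sphereProb H), orbitAverage e f x = g x := by
  have : ProperSpace (H →L[ℂ] H) := FiniteDimensional.proper_rclike ℂ _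
  have : ProperSpace H := FiniteDimensional.proper_rclike ℂ H
  obtain ⟨f₀, hf₀, hff₀⟩ := hf.1
  have h1 : StronglyMeasurable (f₀ ∘ rotSphere (e := e)) :=
    hf₀.comp_measurable continuous_rotSphere.measurable
  refine ⟨orbitAverage e f₀, (h1.integral_prod_left' (μ := stabHaar e)).measurable, ?_⟩
  have h2 : ∀ᵐ z ∂((stabHaar e).prod (sphereProb H)), f (rotSphere z) = f₀ (rotSphere z) :=
    (measurePreserving_rotSphere e).quasiMeasurePreserving.ae hff₀
  have h3 := (Measure.measurePreserving_swap (μ := sphereProb H)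
    (ν := stabHaar e)).quasiMeasurePreserving.ae h2
  filter_upwards [Measure.ae_ae_of_ae_prod h3] with x hx
  exact integral_congr_ae hx

/-- Integrating against a function invariant under the stabiliser of `e`, one may replace `f` by
its orbit average. -/
theorem integral_mul_orbitAverage [Nontrivial H] (e : H) {f w : sphere (0 : H) 1 → ℂ}
    (hf : Integrable (fun x => w x * f x) (sphereProb H))
    (hw : ∀ (k : stab e) (x : sphere (0 : H) 1), w (rotSphere (k, x)) = w x) :
    ∫ x, w x * f x ∂(sphereProb H) = ∫ x, w x * orbitAverage e f x ∂(sphereProb H) := by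
  have hmp := measurePreserving_rotSphere (H := H) e
  have h1 : ∫ x, w x * f x ∂(sphereProb H)
      = ∫ z, w (rotSphere z) * f (rotSphere z) ∂((stabHaar e).prod (sphereProb H)) := by
    conv_lhs => rw [← hmp.map_eq]
    exact integral_map hmp.measurable.aemeasurable (by rw [hmp.map_eq]; exact hf.1)
  have h2 : Integrable (fun z => w (rotSphere z) * f (rotSphere z))
      ((stabHaar e).prod (sphereProb H)) := integrable_comp_rotSphere e hf
  rw [h1, integral_prod_symm _ h2]
  simp_rw [hw, integral_const_mul]
  rfl

end Measurability

end Average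

/-! ### Averages of frame functions -/

section FrameAverages

variable {H : Type*} [NormedAddCommGroup H] [InnerProductSpace ℂ H] [FiniteDimensional ℂ H]

/-- Every finite probability vector is the vector of the `|⟨e, bᵢ⟩|²` for some orthonormal
basis. -/
theorem exists_basis_with_weights {e : H} (he : ‖e‖ = 1) {n : ℕ}
    (hdim : Module.finrank ℂ H = n) {τ : Fin n → ℝ} (h0 : ∀ i, 0 ≤ τ i) (h1 : ∑ i, τ i = 1) :
    ∃ b : OrthonormalBasis (Fin n) ℂ H, ∀ i, ‖⟪e, b i⟫_ℂ‖ ^ 2 = τ i := by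
  let u : OrthonormalBasis (Fin n) ℂ H := (stdOrthonormalBasis ℂ H).reindex (finCongr hdim)
  let y : H := ∑ i, (Real.sqrt (τ i) : ℂ) • u i
  have hyu : ∀ i, ⟪y, u i⟫_ℂ = Real.sqrt (τ i) := by
    intro i
    have := u.orthonormal.inner_left_fintype (fun i => (Real.sqrt (τ i) : ℂ)) i
    exact this.trans (conj_ofReal _)
  have hy : ‖y‖ = 1 := by
    have h2 := u.sum_sq_norm_inner_left y
    simp_rw [hyu, norm_real, Real.norm_of_nonneg (Real.sqrt_nonneg _), Real.sq_sqrt (h0 _)] at h2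
    rw [h1] at h2
    nlinarith [norm_nonneg y]
  obtain ⟨U, hU⟩ := exists_unitary_of_orthonormal (v := fun _ : Unit => y) (w := fun _ : Unit => e)
    ⟨fun _ => hy, fun i j h => (h (Subsingleton.elim i j)).elim⟩
    ⟨fun _ => he, fun i j h => (h (Subsingleton.elim i j)).elim⟩
  refine ⟨u.map U, fun i => ?_⟩
  rw [OrthonormalBasis.map_apply, ← hU (), LinearIsometryEquiv.inner_map_map, hyu, norm_real,
    Real.norm_of_nonneg (Real.sqrt_nonneg _), Real.sq_sqrt (h0 i)]

/-- Two orthonormal pairs, one of which is obtained from the other by a rotation of the plane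
they span, can be completed to orthonormal bases by the same vectors. -/
theorem exists_bases_rotated (m : ℕ) (hdim : Module.finrank ℂ H = m + 2) {e y : H}
    (he : ‖e‖ = 1) (hy : ‖y‖ = 1) (hey : ⟪e, y⟫_ℂ = 0) {a c : ℝ} (hac : a ^ 2 + c ^ 2 = 1) :
    ∃ b b' : OrthonormalBasis (Fin (m + 2)) ℂ H, b 0 = e ∧ b 1 = y ∧
      b' 0 = (a : ℂ) • e + (c : ℂ) • y ∧ b' 1 = (c : ℂ) • e - (a : ℂ) • y ∧
      ∀ i : Fin m, b' i.succ.succ = b i.succ.succ := by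
  have hye : ⟪y, e⟫_ℂ = 0 := by rw [← inner_conj_symm, hey, map_zero]
  have hee : ⟪e, e⟫_ℂ = 1 := by rw [inner_self_eq_norm_sq_to_K, he]; simp
  have hyy : ⟪y, y⟫_ℂ = 1 := by rw [inner_self_eq_norm_sq_to_K, hy]; simp
  have hcard : Module.finrank ℂ H = Fintype.card (Fin (m + 2)) := by rw [Fintype.card_fin, hdim]
  have hacc : (a : ℂ) * a + c * c = 1 := by
    have : a * a + c * c = 1 := by linarith
    exact_mod_cast this
  obtain ⟨b, hb⟩ : ∃ b : OrthonormalBasis (Fin (m + 2)) ℂ H, b 0 = e ∧ b 1 = y := by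
    have hon : Orthonormal ℂ (({0, 1} : Set (Fin (m + 2))).domRestrict
        (fun i => if i = 0 then e else y)) := by
      refine ⟨?_, ?_⟩
      · rintro ⟨i, rfl | rfl⟩
        · exact he
        · exact hy
      · rintro ⟨i, rfl | rfl⟩ ⟨j, rfl | rfl⟩ hij
        · exact (hij rfl).elim
        · exact hey
        · exact hye
        · exact (hij rfl).elim
    obtain ⟨b, hb⟩ := hon.exists_orthonormalBasis_extension_of_card_eq hcard
    exact ⟨b, by simpa using hb 0 (by simp), by simpa using hb 1 (by simp)⟩
  obtain ⟨hb0, hb1⟩ := hb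
  have hbe : ∀ i : Fin m, ⟪e, b i.succ.succ⟫_ℂ = 0 := fun i => by
    rw [← hb0]
    exact b.orthonormal.2 (Fin.succ_ne_zero _).symm
  have hby : ∀ i : Fin m, ⟪y, b i.succ.succ⟫_ℂ = 0 := fun i => by
    rw [← hb1]
    refine b.orthonormal.2 fun h => ?_
    exact Fin.succ_ne_zero i (Fin.succ_injective (m + 1) (a₁ := 0) (a₂ := i.succ) h).symm
  let v : Fin (m + 2) → H := Fin.cons ((a : ℂ) • e + (c : ℂ) • y)
    (Fin.cons ((c : ℂ) • e - (a : ℂ) • y) fun i => b i.succ.succ)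
  have hv : Orthonormal ℂ v := by
    have hsym : ∀ i j, ⟪v i, v j⟫_ℂ = 0 → ⟪v j, v i⟫_ℂ = 0 := fun i j h => by
      rw [← inner_conj_symm, h, map_zero]
    have h01 : ⟪v 0, v 1⟫_ℂ = 0 := by
      change ⟪(a : ℂ) • e + (c : ℂ) • y, (c : ℂ) • e - (a : ℂ) • y⟫_ℂ = 0
      simp only [inner_add_left, inner_sub_right, inner_smul_left, inner_smul_right, hee, hyy, hey,
        hye, conj_ofReal]
      ring
    have h0i : ∀ i : Fin m, ⟪v 0, v i.succ.succ⟫_ℂ = 0 := fun i => by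
      change ⟪(a : ℂ) • e + (c : ℂ) • y, b i.succ.succ⟫_ℂ = 0
      simp only [inner_add_left, inner_smul_left, hbe, hby]
      ring
    have h1i : ∀ i : Fin m, ⟪v 1, v i.succ.succ⟫_ℂ = 0 := fun i => by
      change ⟪(c : ℂ) • e - (a : ℂ) • y, b i.succ.succ⟫_ℂ = 0
      simp only [inner_sub_left, inner_smul_left, hbe, hby]
      ring
    have hunit : ∀ x : H, ⟪x, x⟫_ℂ = 1 → ‖x‖ = 1 := fun x hx => by
      have : ‖x‖ ^ 2 = 1 := by rw [norm_sq_eq_re_inner (𝕜 := ℂ), hx]; simp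
      nlinarith [norm_nonneg x]
    refine ⟨fun i => ?_, fun i j hij => ?_⟩
    · refine Fin.cases ?_ (fun i => Fin.cases ?_ (fun i => ?_) i) i
      · refine hunit _ ?_
        change ⟪(a : ℂ) • e + (c : ℂ) • y, (a : ℂ) • e + (c : ℂ) • y⟫_ℂ = 1
        simp only [inner_add_left, inner_add_right, inner_smul_left, inner_smul_right, hee, hyy,
          hey, hye, conj_ofReal]
        linear_combination hacc
      · refine hunit _ ?_
        change ⟪(c : ℂ) • e - (a : ℂ) • y, (c : ℂ) • e - (a : ℂ) • y⟫_ℂ = 1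
        simp only [inner_sub_left, inner_sub_right, inner_smul_left, inner_smul_right, hee, hyy,
          hey, hye, conj_ofReal]
        linear_combination hacc
      · exact b.orthonormal.1 _
    · revert hij
      refine Fin.cases ?_ (fun i => Fin.cases ?_ (fun i => ?_) i) i <;>
        refine Fin.cases ?_ (fun j => Fin.cases ?_ (fun j => ?_) j) j <;> intro hij
      · exact (hij rfl).elim
      · exact h01
      · exact h0i j
      · exact hsym _ _ h01
      · exact (hij rfl).elim
      · exact h1i j
      · exact hsym _ _ (h0i i)
      · exact hsym _ _ (h1i i)
      · exact b.orthonormal.2 hij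
  obtain ⟨b', hb'⟩ := (hv.comp _ Subtype.val_injective :
    Orthonormal ℂ ((univ : Set (Fin (m + 2))).domRestrict v)).exists_orthonormalBasis_extension_of_card_eq
      hcard
  exact ⟨b, b', hb0, hb1, hb' 0 trivial, hb' 1 trivial, fun i => hb' _ trivial⟩

variable [CompleteSpace H]

/-- The function `h` with `orbitAverage e (F ∘ toProj) x = h (|⟨e, x⟩|²)`. -/
def zonalProfile (e : H) (F : PH H → ℂ) : ℝ → ℂ :=
  Function.extend (fun x : sphere (0 : H) 1 => ‖⟪e, (x : H)⟫_ℂ‖ ^ 2)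
    (orbitAverage e (F ∘ toProj)) 0

theorem zonalProfile_apply {e : H} (he : ‖e‖ = 1) (F : PH H → ℂ) (x : sphere (0 : H) 1) :
    zonalProfile e F (‖⟪e, (x : H)⟫_ℂ‖ ^ 2) = orbitAverage e (F ∘ toProj) x := by
  have hfac : Function.FactorsThrough (orbitAverage e (F ∘ toProj))
      (fun x : sphere (0 : H) 1 => ‖⟪e, (x : H)⟫_ℂ‖ ^ 2) := ?_
  · exact hfac.extend_apply 0 x
  intro x x' hxx'
  exact (orbit_congr he F
    ((pow_left_inj₀ (norm_nonneg _) (norm_nonneg _) two_ne_zero).mp hxx'.symm)).2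

/-- The values `t` for which `F` is integrable over the orbits with `|⟨e, x⟩|² = t`. -/
def goodValues (e : H) (F : PH H → ℂ) : Set ℝ :=
  {t | ∀ x : sphere (0 : H) 1, ‖⟪e, (x : H)⟫_ℂ‖ ^ 2 = t → OrbitIntegrable e (F ∘ toProj) x}

theorem mem_goodValues {e : H} (he : ‖e‖ = 1) {F : PH H → ℂ} {x : sphere (0 : H) 1}
    (hx : OrbitIntegrable e (F ∘ toProj) x) : ‖⟪e, (x : H)⟫_ℂ‖ ^ 2 ∈ goodValues e F :=
  fun _ hx' => (orbit_congr he F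
    ((pow_left_inj₀ (norm_nonneg _) (norm_nonneg _) two_ne_zero).mp hx'.symm)).1 hx

theorem orbit_self {e : H} (he : ‖e‖ = 1) (F : PH H → ℂ) (k : stab e) :
    (F ∘ toProj) (rotSphere (k, (⟨e, by simpa using he⟩ : sphere (0 : H) 1)))
      = F (toProj ⟨e, by simpa using he⟩) := by
  refine congrArg F (congrArg toProj (Subtype.ext ?_))
  exact rot_self k

theorem one_mem_goodValues {e : H} (he : ‖e‖ = 1) (F : PH H → ℂ) : 1 ∈ goodValues e F := by
  have h1 : OrbitIntegrable e (F ∘ toProj) ⟨e, by simpa using he⟩ := by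
    unfold OrbitIntegrable
    simp_rw [orbit_self he F]
    exact integrable_const _
  have h2 := mem_goodValues he h1
  have h3 : ‖⟪e, e⟫_ℂ‖ ^ 2 = 1 := by rw [inner_self_eq_norm_sq_to_K, he]; simp
  rwa [h3] at h2

theorem zonalProfile_one {e : H} (he : ‖e‖ = 1) (F : PH H → ℂ) :
    zonalProfile e F 1 = F (toProj ⟨e, by simpa using he⟩) := by
  have h2 := zonalProfile_apply he F ⟨e, by simpa using he⟩
  have h3 : ‖⟪e, e⟫_ℂ‖ ^ 2 = 1 := by rw [inner_self_eq_norm_sq_to_K, he]; simp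
  rw [h3] at h2
  rw [h2]
  unfold orbitAverage
  simp_rw [orbit_self he F]
  simp

variable {F : PH H → ℂ} {W : ℂ}

theorem sum_rotated_basis
    (hF : ∀ N : Finset (PH H), IsProjBasis (N : Set (PH H)) → ∑ p ∈ N, F p = W)
    {e : H} (k : stab e) {ι : Type*} [Fintype ι] (b : OrthonormalBasis ι ℂ H) :
    ∑ i, (F ∘ toProj) (rotSphere (k, basisVec b i)) = W := by
  rw [← sum_frame_orthonormalBasis hF (b.map (rot k))]
  refine Finset.sum_congr rfl fun i _ => congrArg F (congrArg toProj (Subtype.ext ?_))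
  exact (b.map_apply (rot k) i).symm

/-- The frame property passes to the zonal profile. If all values but one are known to be good,
then so is the last one. -/
theorem frame_zonalProfile
    (hF : ∀ N : Finset (PH H), IsProjBasis (N : Set (PH H)) → ∑ p ∈ N, F p = W)
    {e : H} (he : ‖e‖ = 1) {n : ℕ} (hdim : Module.finrank ℂ H = n) {τ : Fin n → ℝ}
    (h0 : ∀ i, 0 ≤ τ i) (h1 : ∑ i, τ i = 1) (i₀ : Fin n)
    (hgood : ∀ i ≠ i₀, τ i ∈ goodValues e F) :
    τ i₀ ∈ goodValues e F ∧ ∑ i, zonalProfile e F (τ i) = W := by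
  classical
  obtain ⟨b, hb⟩ := exists_basis_with_weights he hdim h0 h1
  have hint : ∀ i ≠ i₀, OrbitIntegrable e (F ∘ toProj) (basisVec b i) := fun i hi =>
    hgood i hi _ (hb i)
  have hlast : OrbitIntegrable e (F ∘ toProj) (basisVec b i₀) := by
    have h2 : ∀ k : stab e, (F ∘ toProj) (rotSphere (k, basisVec b i₀))
        = W - ∑ i ∈ Finset.univ.erase i₀, (F ∘ toProj) (rotSphere (k, basisVec b i)) := by
      intro k
      rw [← sum_rotated_basis hF k b, ← Finset.add_sum_erase _ _ (Finset.mem_univ i₀)]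
      ring
    unfold OrbitIntegrable
    simp_rw [h2]
    exact (integrable_const W).sub
      (integrable_finsetSum _ fun i hi => hint i (Finset.ne_of_mem_erase hi))
  have hall : ∀ i, OrbitIntegrable e (F ∘ toProj) (basisVec b i) := fun i => by
    by_cases hi : i = i₀
    · rw [hi]; exact hlast
    · exact hint i hi
  refine ⟨?_, ?_⟩
  · rw [← hb i₀]
    exact mem_goodValues he hlast
  · have h3 : ∀ i, zonalProfile e F (τ i) = orbitAverage e (F ∘ toProj) (basisVec b i) := fun i => by
      rw [← hb i]
      exact zonalProfile_apply he F (basisVec b i)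
    simp_rw [h3]
    unfold orbitAverage
    rw [← integral_finsetSum _ fun i _ => hall i]
    simp_rw [sum_rotated_basis hF]
    simp

/-- The frame property for two bases that differ by a rotation in a plane through `e` shows that
the orbit of the vectors orthogonal to `e` is good. -/
theorem zero_mem_goodValues
    (hF : ∀ N : Finset (PH H), IsProjBasis (N : Set (PH H)) → ∑ p ∈ N, F p = W)
    {e : H} (he : ‖e‖ = 1) (m : ℕ) (hdim : Module.finrank ℂ H = m + 2) {t : ℝ}
    (ht : t ∈ Icc (0 : ℝ) 1) (h1 : t ∈ goodValues e F) (h2 : 1 - t ∈ goodValues e F) :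
    0 ∈ goodValues e F := by
  have hee : ⟪e, e⟫_ℂ = 1 := by rw [inner_self_eq_norm_sq_to_K, he]; simp
  have hs0 : Real.sqrt t ^ 2 = t := Real.sq_sqrt ht.1
  have hs1 : Real.sqrt (1 - t) ^ 2 = 1 - t := Real.sq_sqrt (by linarith [ht.2])
  intro y hy
  have hey : ⟪e, (y : H)⟫_ℂ = 0 := by simpa using hy
  obtain ⟨b, b', hb0, hb1, hb0', hb1', hrest⟩ := exists_bases_rotated m hdim he
    (norm_eq_of_mem_sphere y) hey (a := Real.sqrt t) (c := Real.sqrt (1 - t))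
    (by rw [hs0, hs1]; ring)
  have hg0 : OrbitIntegrable e (F ∘ toProj) (basisVec b' 0) := by
    refine h1 _ ?_
    change ‖⟪e, b' 0⟫_ℂ‖ ^ 2 = t
    rw [hb0', inner_add_right, inner_smul_right, inner_smul_right, hee, hey, mul_one, mul_zero,
      add_zero, norm_real, Real.norm_of_nonneg (Real.sqrt_nonneg _), hs0]
  have hg1 : OrbitIntegrable e (F ∘ toProj) (basisVec b' 1) := by
    refine h2 _ ?_
    change ‖⟪e, b' 1⟫_ℂ‖ ^ 2 = 1 - t
    rw [hb1', inner_sub_right, inner_smul_right, inner_smul_right, hee, hey, mul_one, mul_zero,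
      sub_zero, norm_real, Real.norm_of_nonneg (Real.sqrt_nonneg _), hs1]
  have key : ∀ k : stab e, (F ∘ toProj) (rotSphere (k, y))
      = (F ∘ toProj) (rotSphere (k, basisVec b' 0)) + (F ∘ toProj) (rotSphere (k, basisVec b' 1))
        - F (toProj ⟨e, by simpa using he⟩) := by
    intro k
    have h3 := sum_rotated_basis hF k b
    have h4 := sum_rotated_basis hF k b'
    rw [Fin.sum_univ_succ, Fin.sum_univ_succ] at h3 h4
    have h5 : ∀ i : Fin m, basisVec b' i.succ.succ = basisVec b i.succ.succ := fun i =>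
      Subtype.ext (hrest i)
    have h6 : basisVec b 0 = ⟨e, by simpa using he⟩ := Subtype.ext hb0
    have h7 : basisVec b (Fin.succ 0) = y := Subtype.ext hb1
    simp_rw [h5] at h4
    rw [h6, h7, orbit_self he F] at h3
    have h8 : (Fin.succ 0 : Fin (m + 2)) = 1 := rfl
    rw [h8] at h4
    linear_combination h3 - h4
  unfold OrbitIntegrable
  simp_rw [key]
  exact (Integrable.add hg0 hg1).sub (integrable_const _)

/-- The frame property for bases with at most three vectors not orthogonal to `e`. -/
theorem three_term
    (hF : ∀ N : Finset (PH H), IsProjBasis (N : Set (PH H)) → ∑ p ∈ N, F p = W)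
    {e : H} (he : ‖e‖ = 1) (m : ℕ) (hdim : Module.finrank ℂ H = m + 3)
    (hz : 0 ∈ goodValues e F) {r s t : ℝ} (hr : 0 ≤ r) (hs : 0 ≤ s) (ht : 0 ≤ t)
    (hsum : r + s + t = 1) (hrg : r ∈ goodValues e F) (hsg : s ∈ goodValues e F) :
    t ∈ goodValues e F ∧ zonalProfile e F r + zonalProfile e F s + zonalProfile e F t
      + m * zonalProfile e F 0 = W := by
  have h := frame_zonalProfile hF he hdim
    (τ := (Fin.cons t (Fin.cons s (Fin.cons r fun _ => 0)) : Fin (m + 3) → ℝ)) ?_ ?_ 0 ?_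
  · refine ⟨h.1, ?_⟩
    have h2 := h.2
    simp only [Fin.sum_univ_succ, Fin.cons_zero, Fin.cons_succ, Finset.sum_const,
      Finset.card_univ, Fintype.card_fin, nsmul_eq_mul] at h2
    linear_combination h2
  · intro i
    refine Fin.cases ht (fun i => Fin.cases hs (fun i => Fin.cases hr (fun i => ?_) i) i) i
    exact le_rfl
  · simp only [Fin.sum_univ_succ, Fin.cons_zero, Fin.cons_succ, Finset.sum_const_zero]
    linarith
  · intro i
    refine Fin.cases (fun h => (h rfl).elim) (fun i _ => Fin.cases hsg (fun i => Fin.cases hrg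
      (fun i => ?_) i) i) i
    exact hz

variable [MeasurableSpace H] [BorelSpace H]

/-- The zonal profile of an integrable frame function is affine. -/
theorem zonalProfile_affine
    (hF : ∀ N : Finset (PH H), IsProjBasis (N : Set (PH H)) → ∑ p ∈ N, F p = W)
    (hint : Integrable (F ∘ toProj) (sphereProb H))
    {e : H} (he : ‖e‖ = 1) (m : ℕ) (hdim : Module.finrank ℂ H = m + 3) :
    zonalProfile e F 1 + (m + 2) * zonalProfile e F 0 = W ∧
    ∀ t ∈ Icc (0 : ℝ) 1, zonalProfile e F t
      = zonalProfile e F 0 + t * (zonalProfile e F 1 - zonalProfile e F 0) := by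
  have : Nontrivial H := Module.nontrivial_of_finrank_pos (R := ℂ) (by omega)
  obtain ⟨g, hgm, hg⟩ := exists_measurable_orbitAverage e hint
  obtain ⟨q, hqc, hq, hae⟩ := exists_slice (by omega) he ((ae_orbitIntegrable e hint).and hg)
  have hgood : ∀ᵐ t : ℝ, t ∈ Ioo (0 : ℝ) 1 → t ∈ goodValues e F := by
    filter_upwards [hae] with t ht h01
    have := mem_goodValues he (ht h01).1
    rwa [hq t ⟨h01.1.le, h01.2.le⟩] at this
  have hmeas : ∀ᵐ t : ℝ, t ∈ Ioo (0 : ℝ) 1 → zonalProfile e F t = g (q t) := by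
    filter_upwards [hae] with t ht h01
    rw [← (ht h01).2, ← zonalProfile_apply he, hq t ⟨h01.1.le, h01.2.le⟩]
  -- every `u` is a sum of two good values, since almost all values are good
  have hsplit : ∀ u ∈ Ioc (0 : ℝ) 1, ∃ t ∈ Ioo (0 : ℝ) u, t ∈ goodValues e F ∧
      u - t ∈ goodValues e F := by
    intro u hu
    have h1 : ∀ᵐ t : ℝ, u - t ∈ Ioo (0 : ℝ) 1 → u - t ∈ goodValues e F :=
      (Measure.measurePreserving_sub_left volume u).quasiMeasurePreserving.ae hgood
    obtain ⟨t, ht, h2, h3⟩ := (Measure.dense_of_ae (hgood.and h1)).inter_open_nonempty _ isOpen_Ioo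
      (nonempty_Ioo.mpr hu.1)
    have hu1 := hu.2
    exact ⟨t, ht, h2 ⟨ht.1, by linarith [ht.2]⟩, h3 ⟨by linarith [ht.2], by linarith [ht.1]⟩⟩
  have hz : 0 ∈ goodValues e F := by
    obtain ⟨t, ht, h1, h2⟩ := hsplit 1 ⟨one_pos, le_rfl⟩
    exact zero_mem_goodValues hF he (m + 1) hdim ⟨ht.1.le, ht.2.le⟩ h1 h2
  have hadd : ∀ s t : ℝ, 0 ≤ s → 0 ≤ t → s + t ≤ 1 → s ∈ goodValues e F → t ∈ goodValues e F →
      s + t ∈ goodValues e F ∧ zonalProfile e F (s + t) + zonalProfile e F 0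
        = zonalProfile e F s + zonalProfile e F t := by
    intro s t hs ht hst hsg htg
    obtain ⟨h1, h2⟩ := three_term hF he m hdim hz hs ht (t := 1 - s - t) (by linarith) (by ring)
      hsg htg
    obtain ⟨h3, h4⟩ := three_term hF he m hdim hz le_rfl (by linarith) (r := 0) (s := 1 - s - t)
      (t := s + t) (by linarith) (by ring) hz h1
    exact ⟨h3, by linear_combination h4 - h2⟩
  have hall : ∀ u ∈ Icc (0 : ℝ) 1, u ∈ goodValues e F := by
    intro u hu
    rcases eq_or_lt_of_le hu.1 with rfl | hu0
    · exact hz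
    · obtain ⟨t, ht, h1, h2⟩ := hsplit u ⟨hu0, hu.2⟩
      have := (hadd t (u - t) ht.1.le (by linarith [ht.2]) (by linarith [hu.2]) h1 h2).1
      rwa [add_sub_cancel] at this
  refine ⟨?_, ?_⟩
  · have := (three_term hF he m hdim hz zero_le_one le_rfl (r := 1) (s := 0) (t := 0) le_rfl
      (by ring) (one_mem_goodValues he F) hz).2
    linear_combination this
  · intro t ht
    have hlin := eq_mul_of_additive
      (a := fun t => zonalProfile e F t - zonalProfile e F 0)
      (a₀ := fun t => g (q t) - zonalProfile e F 0) ?_ ?_ ?_ ht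
    · linear_combination hlin
    · intro s t hs ht hst
      have := (hadd s t hs ht hst (hall s ⟨hs, by linarith⟩) (hall t ⟨ht, by linarith⟩)).2
      linear_combination this
    · exact (hgm.comp hqc.measurable).sub_const _
    · filter_upwards [hmeas] with t ht h01
      rw [ht h01]

/-- A frame function is recovered from its mean against the transition probabilities. -/
theorem integral_transition_mul
    (hF : ∀ N : Finset (PH H), IsProjBasis (N : Set (PH H)) → ∑ p ∈ N, F p = W)
    (hint : Integrable (F ∘ toProj) (sphereProb H)) (m : ℕ) (hdim : Module.finrank ℂ H = m + 3)
    (e : sphere (0 : H) 1) :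
    ∫ x : sphere (0 : H) 1, ((‖⟪(e : H), (x : H)⟫_ℂ‖ ^ 2 : ℝ) : ℂ) * F (toProj x) ∂(sphereProb H)
      = (F (toProj e) + W) / ((m + 3) * (m + 4)) := by
  have : Nontrivial H := Module.nontrivial_of_finrank_pos (R := ℂ) (by omega)
  have : ProperSpace H := FiniteDimensional.proper_rclike ℂ H
  have he : ‖(e : H)‖ = 1 := norm_eq_of_mem_sphere e
  obtain ⟨hW, haff⟩ := zonalProfile_affine hF hint he m hdim
  rw [zonalProfile_one he] at hW haff
  change F (toProj e) + (m + 2) * zonalProfile (e : H) F 0 = W at hW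
  set h0 := zonalProfile (e : H) F 0
  have hle : ∀ x : sphere (0 : H) 1, ‖⟪(e : H), (x : H)⟫_ℂ‖ ≤ 1 := fun x => by
    simpa using norm_inner_le_norm (𝕜 := ℂ) (e : H) (x : H)
  have hw : Continuous fun x : sphere (0 : H) 1 =>
      ((‖⟪(e : H), (x : H)⟫_ℂ‖ ^ 2 : ℝ) : ℂ) := continuous_ofReal.comp (by fun_prop)
  have hi : Integrable (fun x : sphere (0 : H) 1 => ((‖⟪(e : H), (x : H)⟫_ℂ‖ ^ 2 : ℝ) : ℂ)
      * (F ∘ toProj) x) (sphereProb H) := by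
    refine hint.bdd_mul hw.aestronglyMeasurable (c := 1) (Filter.Eventually.of_forall fun x => ?_)
    rw [norm_real, norm_pow, norm_norm]
    exact pow_le_one₀ (norm_nonneg _) (hle x)
  have h1 := integral_mul_orbitAverage (e : H) hi fun k x => by
    have : ⟪(e : H), (rotSphere (k, x) : H)⟫_ℂ = ⟪(e : H), (x : H)⟫_ℂ := inner_rot k (x : H)
    rw [this]
  have h2 : ∀ x : sphere (0 : H) 1, ((‖⟪(e : H), (x : H)⟫_ℂ‖ ^ 2 : ℝ) : ℂ)
      * orbitAverage (e : H) (F ∘ toProj) x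
      = h0 * ((‖⟪(e : H), (x : H)⟫_ℂ‖ ^ 2 : ℝ) : ℂ)
        + (F (toProj e) - h0) * ((‖⟪(e : H), (x : H)⟫_ℂ‖ ^ 4 : ℝ) : ℂ) := by
    intro x
    rw [← zonalProfile_apply he, haff _ ⟨by positivity, pow_le_one₀ (norm_nonneg _) (hle x)⟩]
    push_cast
    ring
  obtain ⟨b, hb⟩ : ∃ b : OrthonormalBasis (Fin (m + 3)) ℂ H, b 0 = e := by
    have hon : Orthonormal ℂ (({0} : Set (Fin (m + 3))).domRestrict (fun _ => (e : H))) := by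
      refine ⟨fun _ => he, ?_⟩
      rintro ⟨i, rfl⟩ ⟨j, rfl⟩ hij
      exact (hij rfl).elim
    obtain ⟨b, hb⟩ := hon.exists_orthonormalBasis_extension_of_card_eq (by simp [hdim])
    exact ⟨b, hb 0 rfl⟩
  have h4 := integral_fourth b 0
  have h5 := integral_sq b 0
  rw [h4] at h5
  rw [hb, Fintype.card_fin] at h4 h5
  have hi2 : Integrable (fun x : sphere (0 : H) 1 =>
      h0 * ((‖⟪(e : H), (x : H)⟫_ℂ‖ ^ 2 : ℝ) : ℂ)) (sphereProb H) :=
    integrable_of_continuous_sphere (continuous_const.mul hw)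
  have hi4 : Integrable (fun x : sphere (0 : H) 1 =>
      (F (toProj e) - h0) * ((‖⟪(e : H), (x : H)⟫_ℂ‖ ^ 4 : ℝ) : ℂ)) (sphereProb H) :=
    integrable_of_continuous_sphere
      (continuous_const.mul (continuous_ofReal.comp (by fun_prop)))
  refine h1.trans ?_
  simp_rw [h2]
  rw [integral_add hi2 hi4, integral_const_mul, integral_const_mul, integral_complex_ofReal,
    integral_complex_ofReal, h4, h5, ← hW]
  have hm3 : (m : ℂ) + 3 ≠ 0 := by exact_mod_cast Nat.succ_ne_zero (m + 2)
  have hm4 : (m : ℂ) + 4 ≠ 0 := by exact_mod_cast Nat.succ_ne_zero (m + 3)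
  have hm4' : (m : ℂ) + 3 + 1 ≠ 0 := by exact_mod_cast Nat.succ_ne_zero (m + 3)
  push_cast
  field_simp
  ring

end FrameAverages

/-! ### Frame functions are expectation values -/

section Regularity

variable {H : Type*} [NormedAddCommGroup H] [InnerProductSpace ℂ H] [FiniteDimensional ℂ H]
  [CompleteSpace H]

/-- **Gleason's theorem for square-integrable frame functions**: in dimension at least three they
are of the form `p ↦ tr (pA)`. -/
theorem exists_eq_tr (hdim : 2 < Module.finrank ℂ H) {F : PH H → ℂ} (hF : F ∈ frameL2 H) :
    ∃ A : H →L[ℂ] H, ∀ p : PH H, F p = tr ((p : H →L[ℂ] H) * A) := by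
  obtain ⟨m, hm⟩ : ∃ m, Module.finrank ℂ H = m + 3 := ⟨Module.finrank ℂ H - 3, by omega⟩
  have : Nontrivial H := Module.nontrivial_of_finrank_pos (R := ℂ) (by omega)
  let _ : MeasurableSpace H := borel H
  have : BorelSpace H := ⟨rfl⟩
  have : ProperSpace (H →L[ℂ] H) := FiniteDimensional.proper_rclike ℂ _
  obtain ⟨hL2, W, hW⟩ := hF
  have hint : Integrable F (projMeasure H) := hL2.integrable one_le_two
  have hmap : MeasurePreserving (toProj (H := H)) (sphereProb H) (projMeasure H) :=
    ⟨continuous_toProj.measurable, projMeasure_eq_map.symm⟩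
  have hint' : Integrable (F ∘ toProj) (sphereProb H) := hmap.integrable_comp_of_integrable hint
  have hvec : Integrable (fun p : PH H => F p • (p : H →L[ℂ] H)) (projMeasure H) := by
    refine hint.smul_bdd 1 continuous_subtype_val.aestronglyMeasurable
      (Filter.Eventually.of_forall fun p => ?_)
    obtain ⟨ψ, rfl⟩ := toProj_surjective p
    change ‖InnerProductSpace.rankOne ℂ (ψ : H) (ψ : H)‖ ≤ 1
    simp
  let B : H →L[ℂ] H := ∫ p : PH H, F p • (p : H →L[ℂ] H) ∂(projMeasure H)
  have hB : ∀ e : sphere (0 : H) 1, tr ((toProj e : H →L[ℂ] H) * B)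
      = (F (toProj e) + W) / ((m + 3) * (m + 4)) := by
    intro e
    let L : (H →L[ℂ] H) →L[ℂ] ℂ :=
      trCLM.comp (ContinuousLinearMap.mul ℂ (H →L[ℂ] H) (toProj e : H →L[ℂ] H))
    have h1 : tr ((toProj e : H →L[ℂ] H) * B)
        = ∫ p : PH H, L (F p • (p : H →L[ℂ] H)) ∂(projMeasure H) :=
      (L.integral_comp_comm hvec).symm
    have h2 : Integrable (fun p : PH H => L (F p • (p : H →L[ℂ] H))) (projMeasure H) :=
      L.integrable_comp hvec
    rw [h1, ← integral_transition_mul hW hint' m hm e, ← hmap.map_eq,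
      integral_map hmap.measurable.aemeasurable (by rw [hmap.map_eq]; exact h2.1)]
    congr 1
    ext x
    have h3 : L (toProj x : H →L[ℂ] H) = ((‖⟪(e : H), (x : H)⟫_ℂ‖ ^ 2 : ℝ) : ℂ) := by
      change tr ((toProj e : H →L[ℂ] H) * (toProj x : H →L[ℂ] H)) = _
      rw [tr_toProj_mul_toProj]
    rw [map_smul, h3, smul_eq_mul, mul_comm]
  refine ⟨(((m : ℂ) + 3) * (m + 4)) • B - W • 1, fun p => ?_⟩
  obtain ⟨e, rfl⟩ := toProj_surjective p
  have hm3 : (m : ℂ) + 3 ≠ 0 := by exact_mod_cast Nat.succ_ne_zero (m + 2)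
  have hm4 : (m : ℂ) + 4 ≠ 0 := by exact_mod_cast Nat.succ_ne_zero (m + 3)
  rw [mul_sub, tr_sub, mul_smul_comm, mul_smul_comm, mul_one, tr_smul, tr_smul, tr_toProj, hB]
  field_simp
  ring

theorem exists_eq_obs (hdim : 2 < Module.finrank ℂ H) {κ : ℝ} (hκ : κ ≠ 0) {F : PH H → ℂ}
    (hF : F ∈ frameL2 H) : ∃ A : H →L[ℂ] H, obs κ A = F := by
  obtain ⟨A, hA⟩ := exists_eq_tr hdim hF
  have hn : (Module.finrank ℂ H : ℂ) ≠ 0 := by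
    have : Module.finrank ℂ H ≠ 0 := by omega
    exact_mod_cast this
  have hκ' : (κ : ℂ) ≠ 0 := by exact_mod_cast hκ
  have h1 : tr (1 : H →L[ℂ] H) = Module.finrank ℂ H := LinearMap.trace_one ℂ H
  refine ⟨(κ : ℂ)⁻¹ • (A - ((1 - κ) / Module.finrank ℂ H * tr A) • 1), ?_⟩
  ext p
  rw [hA, obs, mul_smul_comm, mul_sub, mul_smul_comm, mul_one, tr_smul, tr_smul, tr_sub, tr_sub,
    tr_smul, tr_smul, tr_coe, h1]
  field_simp
  ring

end Regularity

end GeomQM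
end

theorem theorem4p3 {H : Type*} [NormedAddCommGroup H] [InnerProductSpace ℂ H] [CompleteSpace H]
    [FiniteDimensional ℂ H] (n : ℕ) (hdim : Module.finrank ℂ H = n) (hn : 2 < n)
    (κ : ℝ) (hκ : 0 < κ) :
    -- `𝒪` is a bijection onto `𝓕²(H)`, whose elements are smooth: all objects below make sense
    BijOn (GeomQM.obs κ) (univ : Set (H →L[ℂ] H)) (GeomQM.frameL2 H) ∧
    (∀ f ∈ GeomQM.frameL2 H, GeomQM.IsSmooth f) ∧
    ∀ f ∈ GeomQM.frameL2 H, ∀ g ∈ GeomQM.frameL2 H,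
      (∀ p : GeomQM.PH H, GeomQM.starProd κ f g p =
        I / 2 * GeomQM.poisson hκ f g p + 1 / 2 * GeomQM.gradProd hκ f g p + f p * g p / κ
        + (1 - κ) / κ * ((n + 1) / κ * (∫ q, f q * g q ∂(GeomQM.projMeasure H))
          - f p * (∫ q, g q ∂(GeomQM.projMeasure H))
          - g p * (∫ q, f q ∂(GeomQM.projMeasure H)))
        + (1 - κ) / κ ^ 2 * (κ - (n + 1)) * (∫ q, f q ∂(GeomQM.projMeasure H))
          * (∫ q, g q ∂(GeomQM.projMeasure H))) ∧
      (κ = n + 1 → ∀ p : GeomQM.PH H, GeomQM.starProd κ f g p =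
        I / 2 * GeomQM.poisson hκ f g p + 1 / 2 * GeomQM.gradProd hκ f g p
        + 1 / (n + 1) * (f p * g p
          - (∫ q, f q * g q ∂((n : ENNReal) • GeomQM.projMeasure H))
          + f p * (∫ q, g q ∂((n : ENNReal) • GeomQM.projMeasure H))
          + g p * (∫ q, f q ∂((n : ENNReal) • GeomQM.projMeasure H)))) ∧
      (κ = 1 → ∀ p : GeomQM.PH H, GeomQM.starProd κ f g p =
        I / 2 * GeomQM.poisson hκ f g p + 1 / 2 * GeomQM.gradProd hκ f g p + f p * g p) := by
  have hH : 2 < Module.finrank ℂ H := by omega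
  have hH0 : Module.finrank ℂ H ≠ 0 := by omega
  have : Nontrivial H := Module.nontrivial_of_finrank_pos (R := ℂ) (by omega)
  refine ⟨⟨fun A _ => GeomQM.obs_mem_frameL2 κ A hH0, (GeomQM.obs_injective hκ.ne' hH0).injOn,
    fun F hF => ?_⟩, fun F hF => ?_, fun f hf g hg => ?_⟩
  · obtain ⟨A, hA⟩ := GeomQM.exists_eq_obs hH hκ.ne' hF
    exact ⟨A, trivial, hA⟩
  · obtain ⟨A, rfl⟩ := GeomQM.exists_eq_obs hH hκ.ne' hF
    exact GeomQM.isSmooth_obs κ A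
  · obtain ⟨A, rfl⟩ := GeomQM.exists_eq_obs hH hκ.ne' hf
    obtain ⟨B, rfl⟩ := GeomQM.exists_eq_obs hH hκ.ne' hg
    have key := GeomQM.starProd_formula hκ A B
    rw [hdim] at key
    refine ⟨key, fun hκn p => ?_, fun hκ1 p => ?_⟩
    · have hn1 : (n : ℂ) + 1 ≠ 0 := by exact_mod_cast Nat.succ_ne_zero n
      have hκc : (κ : ℂ) = n + 1 := by rw [hκn]; push_cast; ring
      rw [key p, integral_smul_measure, integral_smul_measure, integral_smul_measure, hκc]
      simp only [ENNReal.toReal_natCast, Complex.real_smul, ofReal_natCast]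
      field_simp
      ring
    · have hκc : (κ : ℂ) = 1 := by rw [hκ1, ofReal_one]
      rw [key p, hκc]
      ring
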